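/- **Theorem.** Let $\Psi\colon[0,\infty)\to[0,\infty)$ be an Orlicz function, i.e. convex, strictly increasing, with $\Psi(0)=0$, and define $\psi\colon[0,\infty)\to[0,\infty)$ by $\Psi=e^{\psi}-1$. For a random variable $X$ with values in a Banach space $(F,\|\cdot\|)$ put $$\|X\|_\Psi=\inf\{a>0:\ \mathbb E\,\Psi(\|X\|/a)\le 1\}\in[0,\infty],\qquad \|X\|_1=\mathbb E\|X\|.$$ A Radon random variable is a Borel measurable random variable with values in a separable subspace of $F$. Consider the condition (HJ) there is $K>0$ such that $\psi(su)\le K\big(s\ln(1+s)+s\psi(u)\big)$ for all $s,u\ge K$, and, for a finite sequence $X_1,\dots,X_N$ of random variables on a probability space and a constant $D$, the Hoffmann-Jørgensen inequality $$\Big\|\sum_{i=1}^N X_i\Big\|_\Psi\le D\Big(\Big\|\sum_{i=1}^N X_i\Big\|_1+\Big\|\max_{i\le N}\|X_i\|\Big\|_\Psi\Big).\tag{1}$$ 1. If there is a constant $D<\infty$ such that (1) holds for all finite sequences of i.i.d. symmetric bounded real random variables, then $\Psi$ satisfies (HJ). 2. Conversely, if $\Psi$ satisfies (HJ), then there is a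 constant $D<\infty$, depending only on $\Psi$, such that (1) holds for every Banach space $F$ and every finite sequence of independent $F$-valued Radon random variables. -/

import Mathlib

open MeasureTheory ProbabilityTheory
open scoped NNReal ENNReal

/-- An Orlicz function `Ψ : [0, ∞) → [0, ∞)`: convex, strictly increasing, with `Ψ 0 = 0`.
It is represented by a function on `ℝ` of which only the values on `[0, ∞)` matter;
nonnegativity there follows from the fields. -/
structure IsOrliczFunction (Ψ : ℝ → ℝ) : Prop where
  convexOn : ConvexOn ℝ (Set.Ici 0) Ψ
  strictMonoOn : StrictMonoOn Ψ (Set.Ici 0)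
  map_zero : Ψ 0 = 0

theorem IsOrliczFunction.nonneg {Ψ : ℝ → ℝ} (h : IsOrliczFunction Ψ) {x : ℝ} (hx : 0 ≤ x) :
    0 ≤ Ψ x :=
  h.map_zero ▸ h.strictMonoOn.monotoneOn Set.self_mem_Ici hx hx

/-- The function `ψ` associated with `Ψ` by `Ψ = e ^ ψ - 1`. -/
noncomputable def orliczExponent (Ψ : ℝ → ℝ) (x : ℝ) : ℝ := Real.log (1 + Ψ x)

theorem IsOrliczFunction.eq_exp_sub_one {Ψ : ℝ → ℝ} (h : IsOrliczFunction Ψ) {x : ℝ}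
    (hx : 0 ≤ x) : Ψ x = Real.exp (orliczExponent Ψ x) - 1 := by
  have := h.nonneg hx
  rw [orliczExponent, Real.exp_log (by linarith)]
  ring

/-- The condition (HJ): for some `K > 0` and all `s, u ≥ K`,
`ψ (s u) ≤ K (s ln (1 + s) + s ψ(u))`. -/
def ConditionHJ (Ψ : ℝ → ℝ) : Prop :=
  ∃ K : ℝ, 0 < K ∧ ∀ s u : ℝ, K ≤ s → K ≤ u →
    orliczExponent Ψ (s * u) ≤ K * (s * Real.log (1 + s) + s * orliczExponent Ψ u)

/-- The norm `‖X‖_Ψ = inf {a > 0 : E Ψ(‖X‖ / a) ≤ 1}`, with values in `[0, ∞]`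
(the infimum of the empty set is `∞`). -/
noncomputable def orliczNorm {Ω E : Type*} [MeasurableSpace Ω] [NormedAddCommGroup E]
    (Ψ : ℝ → ℝ) (μ : Measure Ω) (X : Ω → E) : ℝ≥0∞ :=
  ⨅ (a : ℝ≥0) (_ : 0 < a) (_ : ∫⁻ ω, ENNReal.ofReal (Ψ (‖X ω‖ / a)) ∂μ ≤ 1), (a : ℝ≥0∞)

/-- A Radon random variable: Borel measurable, with values in a separable linear subspace. -/
def IsRadonVariable {Ω F : Type*} [MeasurableSpace Ω] [NormedAddCommGroup F] [NormedSpace ℝ F]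
    [MeasurableSpace F] (X : Ω → F) : Prop :=
  Measurable X ∧ ∃ V : Submodule ℝ F, TopologicalSpace.IsSeparable (V : Set F) ∧ ∀ ω, X ω ∈ V

theorem isRadonVariable_iff_stronglyMeasurable {Ω F : Type*} [MeasurableSpace Ω]
    [NormedAddCommGroup F] [NormedSpace ℝ F] [MeasurableSpace F] [BorelSpace F] (X : Ω → F) :
    IsRadonVariable X ↔ StronglyMeasurable X := by
  rw [stronglyMeasurable_iff_measurable_separable]
  refine and_congr_right fun _ => ⟨?_, fun h => ?_⟩
  · rintro ⟨V, hV, hX⟩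
    exact hV.mono (Set.range_subset_iff.2 hX)
  · exact ⟨Submodule.span ℝ (Set.range X), h.span,
      fun ω => Submodule.subset_span (Set.mem_range_self ω)⟩

/-- The Hoffmann-Jørgensen inequality in `L_Ψ` with constant `D` for `X₁, …, X_N`:
`‖∑ Xᵢ‖_Ψ ≤ D (‖∑ Xᵢ‖₁ + ‖max ‖Xᵢ‖‖_Ψ)`, as an inequality in `[0, ∞]`
(for `N = 0` the sum and the maximum are `0`). -/
def HoffmannJorgensenInequality {Ω F : Type*} [MeasurableSpace Ω] [NormedAddCommGroup F]
    (Ψ : ℝ → ℝ) (D : ℝ≥0) (μ : Measure Ω) {N : ℕ} (X : Fin N → Ω → F) : Prop :=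
  orliczNorm Ψ μ (fun ω => ∑ i, X i ω) ≤
    D * (eLpNorm (fun ω => ∑ i, X i ω) 1 μ + orliczNorm Ψ μ (fun ω => ⨆ i, ‖X i ω‖))

/-! Necessity. Test (1) on `k` independent copies of a variable equal to `±u` with probability `p`
each and to `0` otherwise, with `p` of order `1 / (k Ψ(u))`. Then both terms on the right of (1) are
at most `1`. On the event that all copies equal `u`, of probability at least `p ^ k`, the sum is `k
u`, so `Ψ(k u / (2D + 1)) ≤ p ^ (-k)`. Taking logarithms with `k` of order `s` gives (HJ)
(`orlicz_mul_div_le`).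

Sufficiency. Applied to each summand with `s = T / (2 K yᵢ)` and averaged with weights `yᵢ`, (HJ)
bounds `ψ` at a rescaled sum `T = ∑ yᵢ` of `n` terms by `∑ ψ(yᵢ) + n log(1 + 2n)`
(`orliczExponent_sum_le`). After exponentiation the entropy term costs a factor `9 ^ n n!`, so the
probabilistic estimates must gain `1 / n!`.

They do so for both parts of the sum. Restart the walk of partial sums each time it leaves a ball of
radius `t`. If it exits `n` times, its norm is at most `2 (n + 1) t` plus the sum of the steps
larger than `t` (`norm_windowSum_le_of_notMem_multiExit`). The probability of at least `n` exits is
at most `(4 / t) ^ n / n!` (`measure_multiExit_le`), a Poisson rather than geometric tail. For the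
large steps, independence turns the expectation into elementary symmetric functions, and `n! eₙ(w) ≤
(∑ w) ^ n` supplies the factorial (`lintegral_orlicz_sum_large_le`). Convexity of `Ψ` combines the
two parts for centred variables in a separable space. Subtracting means, restricting to a closed
separable subspace and rescaling give the general case. -/

namespace IsOrliczFunction

/-! ### Elementary consequences of convexity. -/

variable {Ψ : ℝ → ℝ}

theorem mono (h : IsOrliczFunction Ψ) {x y : ℝ} (hx : 0 ≤ x) (hxy : x ≤ y) : Ψ x ≤ Ψ y :=
  h.strictMonoOn.monotoneOn hx (hx.trans hxy) hxy

theorem map_mul_le (h : IsOrliczFunction Ψ) {θ x : ℝ} (hθ : 0 ≤ θ) (hθ' : θ ≤ 1) (hx : 0 ≤ x) :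
    Ψ (θ * x) ≤ θ * Ψ x := by
  have := h.convexOn.2 (Set.self_mem_Ici (a := (0 : ℝ))) (Set.mem_Ici.2 hx)
    (sub_nonneg.2 hθ') hθ (by ring)
  simpa [h.map_zero] using this

theorem map_half_add_le (h : IsOrliczFunction Ψ) {x y : ℝ} (hx : 0 ≤ x) (hy : 0 ≤ y) :
    Ψ ((x + y) / 2) ≤ (Ψ x + Ψ y) / 2 := by
  have := h.convexOn.2 (Set.mem_Ici.2 hx) (Set.mem_Ici.2 hy)
    (by norm_num : (0 : ℝ) ≤ 1 / 2) (by norm_num : (0 : ℝ) ≤ 1 / 2) (by norm_num)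
  simp only [smul_eq_mul] at this
  rw [show (x + y) / 2 = 1 / 2 * x + 1 / 2 * y by ring]
  linarith

theorem map_one_pos (h : IsOrliczFunction Ψ) : 0 < Ψ 1 := by
  have := h.strictMonoOn (Set.self_mem_Ici (a := (0 : ℝ))) (Set.mem_Ici.2 zero_le_one) one_pos
  rwa [h.map_zero] at this

theorem mul_map_one_le (h : IsOrliczFunction Ψ) {x : ℝ} (hx : 1 ≤ x) : x * Ψ 1 ≤ Ψ x := by
  have hx0 : 0 < x := by linarith
  have := h.map_mul_le (θ := x⁻¹) (x := x) (by positivity) (inv_le_one_of_one_le₀ hx) hx0.le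
  rw [inv_mul_cancel₀ hx0.ne'] at this
  calc x * Ψ 1 ≤ x * (x⁻¹ * Ψ x) := by gcongr
    _ = Ψ x := by field_simp

/-- Makes a bound on the Orlicz modular control first moments, hence integrability and the size of
the means. -/
theorem le_one_add_div (h : IsOrliczFunction Ψ) {x : ℝ} (hx : 0 ≤ x) : x ≤ 1 + Ψ x / Ψ 1 := by
  have h1 := h.map_one_pos
  rcases le_total x 1 with hx1 | hx1
  · have : 0 ≤ Ψ x / Ψ 1 := div_nonneg (h.nonneg hx) h1.le
    linarith
  · have : x ≤ Ψ x / Ψ 1 := (le_div_iff₀ h1).2 (h.mul_map_one_le hx1)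
    linarith

/-- An explicit positive point where `Ψ ≤ 1`; deterministic shifts are scaled down to it when
variables are centred. -/
theorem map_one_div_le_one (h : IsOrliczFunction Ψ) : Ψ (1 / (1 + Ψ 1)) ≤ 1 := by
  have h1 := h.map_one_pos
  have h2 := h.map_mul_le (θ := 1 / (1 + Ψ 1)) (x := 1) (by positivity)
    (by rw [div_le_one (by positivity)]; linarith) zero_le_one
  rw [mul_one] at h2
  refine h2.trans ?_
  rw [one_div_mul_eq_div, div_le_one (by positivity)]
  linarith

theorem measurable_comp {α : Type*} [MeasurableSpace α] (h : IsOrliczFunction Ψ) {f : α → ℝ}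
    (hf : Measurable f) (hf0 : ∀ a, 0 ≤ f a) : Measurable fun a => Ψ (f a) := by
  -- The values of `Ψ` on negative numbers are arbitrary; truncation at `0` gives a globally
  -- monotone, hence measurable, function.
  have hm : Monotone fun x : ℝ => Ψ (max x 0) := fun x y hxy =>
    h.mono (le_max_right _ _) (max_le_max_right 0 hxy)
  have := hm.measurable.comp hf
  convert this using 2 with a
  simp [hf0 a]

theorem exponent_nonneg (h : IsOrliczFunction Ψ) {x : ℝ} (hx : 0 ≤ x) :
    0 ≤ orliczExponent Ψ x :=
  Real.log_nonneg (by linarith [h.nonneg hx])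

theorem exponent_mono (h : IsOrliczFunction Ψ) {x y : ℝ} (hx : 0 ≤ x) (hxy : x ≤ y) :
    orliczExponent Ψ x ≤ orliczExponent Ψ y :=
  Real.log_le_log (by linarith [h.nonneg hx]) (by linarith [h.mono hx hxy])

theorem exp_exponent (h : IsOrliczFunction Ψ) {x : ℝ} (hx : 0 ≤ x) :
    Real.exp (orliczExponent Ψ x) = 1 + Ψ x := by
  linarith [h.eq_exp_sub_one hx]

end IsOrliczFunction

/-! ### Condition (HJ) for sums of several terms. -/

theorem ConditionHJ.exists_one_le {Ψ : ℝ → ℝ} (hΨ : IsOrliczFunction Ψ) (h : ConditionHJ Ψ) :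
    ∃ K : ℝ, 1 ≤ K ∧ ∀ s u : ℝ, K ≤ s → K ≤ u →
      orliczExponent Ψ (s * u) ≤ K * (s * Real.log (1 + s) + s * orliczExponent Ψ u) := by
  obtain ⟨K, hK, hKs⟩ := h
  refine ⟨max K 1, le_max_right _ _, fun s u hs hu => ?_⟩
  have hs0 : 0 ≤ s := hK.le.trans ((le_max_left _ _).trans hs)
  have hu0 : 0 ≤ u := hK.le.trans ((le_max_left _ _).trans hu)
  refine (hKs s u ((le_max_left _ _).trans hs) ((le_max_left _ _).trans hu)).trans ?_
  have := hΨ.exponent_nonneg hu0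
  have := Real.log_nonneg (by linarith : 1 ≤ 1 + s)
  gcongr
  exact le_max_left _ _

/-- Under (HJ) the exponent of a sum is controlled, up to rescaling, by the sum of the exponents
and an entropy term. -/
theorem orliczExponent_sum_le {Ψ : ℝ → ℝ} (hΨ : IsOrliczFunction Ψ) {K : ℝ} (hK : 1 ≤ K)
    (hHJ : ∀ s u : ℝ, K ≤ s → K ≤ u →
      orliczExponent Ψ (s * u) ≤ K * (s * Real.log (1 + s) + s * orliczExponent Ψ u))
    {ι : Type*} (J : Finset ι) (y : ι → ℝ) (hy : ∀ i ∈ J, K ≤ y i) :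
    orliczExponent Ψ ((∑ i ∈ J, y i) / (2 * K ^ 2)) ≤
      ∑ i ∈ J, orliczExponent Ψ (y i) + J.card * Real.log (1 + 2 * J.card) := by
  classical
  have hK0 : 0 < K := by linarith
  have hy0 : ∀ i ∈ J, 0 < y i := fun i hi => hK0.trans_le (hy i hi)
  have hψ0 : ∀ i ∈ J, 0 ≤ orliczExponent Ψ (y i) := fun i hi => hΨ.exponent_nonneg (hy0 i hi).le
  have hlog : 0 ≤ Real.log (1 + 2 * (J.card : ℝ)) :=
    Real.log_nonneg (by linarith [Nat.cast_nonneg (α := ℝ) J.card])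
  set T := ∑ i ∈ J, y i with hT
  rcases J.eq_empty_or_nonempty with rfl | hJ
  · simp [hT, orliczExponent, hΨ.map_zero]
  have hT0 : 0 < T := Finset.sum_pos hy0 hJ
  have hn : (0 : ℝ) < J.card := by exact_mod_cast hJ.card_pos
  -- If one term dominates, monotonicity suffices. Otherwise every ratio `T / (2 K yᵢ)` is at least
  -- `K`, so (HJ) applies to each term.
  by_cases hbig : ∃ i ∈ J, T / (2 * K ^ 2) ≤ y i
  · obtain ⟨i, hi, hTi⟩ := hbig
    have h1 := hΨ.exponent_mono (by positivity) hTi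
    have h2 := Finset.single_le_sum hψ0 hi
    have : 0 ≤ (J.card : ℝ) * Real.log (1 + 2 * J.card) := by positivity
    linarith
  push Not at hbig
  -- The terms below half the average sum to at most `T / 2`. For the remaining ones the ratio is at
  -- most `2 n`, which bounds the logarithm in (HJ).
  set J' := J.filter fun i => T / (2 * J.card) ≤ y i with hJ'
  have hhalf : T / 2 ≤ ∑ i ∈ J', y i := by
    have hsplit := Finset.sum_filter_add_sum_filter_not J (fun i => T / (2 * J.card) ≤ y i) y
    have hsmall : ∑ i ∈ J with ¬ T / (2 * J.card) ≤ y i, y i ≤ T / 2 := by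
      calc _ ≤ ∑ i ∈ J with ¬ T / (2 * J.card) ≤ y i, T / (2 * J.card) :=
            Finset.sum_le_sum fun i hi => (not_le.1 (Finset.mem_filter.1 hi).2).le
        _ ≤ ∑ i ∈ J, T / (2 * J.card) :=
            Finset.sum_le_sum_of_subset_of_nonneg (Finset.filter_subset _ _)
              fun _ _ _ => by positivity
        _ = T / 2 := by rw [Finset.sum_const, nsmul_eq_mul]; field_simp
    linarith
  set E := orliczExponent Ψ (T / (2 * K)) with hE
  have hE0 : 0 ≤ E := hΨ.exponent_nonneg (by positivity)
  -- (HJ) at `s = T / (2 K yᵢ)`, `u = yᵢ`, multiplied by `yᵢ`: the prefactor `K s yᵢ` is `T / 2`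
  -- whatever `i` is, so summing over `J'` cancels it against `∑ yᵢ ≥ T / 2`.
  have hterm : ∀ i ∈ J', y i * E ≤
      T / 2 * (Real.log (1 + 2 * J.card) + orliczExponent Ψ (y i)) := by
    intro i hi
    obtain ⟨hiJ, hiT⟩ := Finset.mem_filter.1 hi
    have hyi := hy0 i hiJ
    set s := T / (2 * K) / y i with hs
    have hsK : K ≤ s := by
      rw [hs, le_div_iff₀ hyi]
      have := (hbig i hiJ).le
      calc K * y i ≤ K * (T / (2 * K ^ 2)) := by gcongr
        _ = T / (2 * K) := by field_simp
    have hs0 : 0 < s := by positivity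
    have hsn : s ≤ 2 * J.card := by
      rw [hs, div_div, div_le_iff₀ (by positivity)]
      rw [div_le_iff₀ (by positivity)] at hiT
      have : (0 : ℝ) ≤ 2 * J.card * y i := by positivity
      nlinarith
    have h1 := hHJ s (y i) hsK (hy i hiJ)
    rw [show s * y i = T / (2 * K) by rw [hs]; field_simp] at h1
    have hl : Real.log (1 + s) ≤ Real.log (1 + 2 * J.card) :=
      Real.log_le_log (by linarith) (by linarith)
    calc y i * E ≤ y i * (K * (s * Real.log (1 + s) + s * orliczExponent Ψ (y i))) := by gcongr
      _ ≤ y i * (K * (s * Real.log (1 + 2 * J.card) + s * orliczExponent Ψ (y i))) := by gcongr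
      _ = T / 2 * (Real.log (1 + 2 * J.card) + orliczExponent Ψ (y i)) := by
        rw [hs]; field_simp
  have hsum : T / 2 * E ≤
      T / 2 * (∑ i ∈ J, orliczExponent Ψ (y i) + J.card * Real.log (1 + 2 * J.card)) := by
    calc T / 2 * E ≤ (∑ i ∈ J', y i) * E := by gcongr
      _ = ∑ i ∈ J', y i * E := Finset.sum_mul _ _ _
      _ ≤ ∑ i ∈ J', T / 2 * (Real.log (1 + 2 * J.card) + orliczExponent Ψ (y i)) :=
        Finset.sum_le_sum hterm
      _ ≤ ∑ i ∈ J, T / 2 * (Real.log (1 + 2 * J.card) + orliczExponent Ψ (y i)) :=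
        Finset.sum_le_sum_of_subset_of_nonneg (Finset.filter_subset _ _) fun i hi _ =>
          mul_nonneg (by positivity) (add_nonneg hlog (hψ0 i hi))
      _ = _ := by
        rw [← Finset.mul_sum, Finset.sum_add_distrib, Finset.sum_const, nsmul_eq_mul]
        ring
  have hfin := le_of_mul_le_mul_left hsum (by positivity)
  refine le_trans (hΨ.exponent_mono (by positivity) ?_) hfin
  gcongr
  nlinarith

/-- Exponentiated form of `orliczExponent_sum_le`. -/
theorem one_add_orlicz_sum_le {Ψ : ℝ → ℝ} (hΨ : IsOrliczFunction Ψ) {K : ℝ} (hK : 1 ≤ K)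
    (hHJ : ∀ s u : ℝ, K ≤ s → K ≤ u →
      orliczExponent Ψ (s * u) ≤ K * (s * Real.log (1 + s) + s * orliczExponent Ψ u))
    {ι : Type*} (J : Finset ι) (y : ι → ℝ) (hy : ∀ i ∈ J, K ≤ y i) :
    1 + Ψ ((∑ i ∈ J, y i) / (2 * K ^ 2)) ≤
      (1 + 2 * (J.card : ℝ)) ^ J.card * ∏ i ∈ J, (1 + Ψ (y i)) := by
  have hK0 : 0 < K := by linarith
  have hy0 : ∀ i ∈ J, 0 ≤ y i := fun i hi => hK0.le.trans (hy i hi)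
  have h := Real.exp_le_exp.2 (orliczExponent_sum_le hΨ hK hHJ J y hy)
  rw [hΨ.exp_exponent (div_nonneg (Finset.sum_nonneg hy0) (by positivity)), Real.exp_add,
    Real.exp_sum, Finset.prod_congr rfl fun i hi => hΨ.exp_exponent (hy0 i hi),
    mul_comm (J.card : ℝ), ← Real.rpow_def_of_pos (by positivity), Real.rpow_natCast] at h
  linarith

/-! ### Passing between the Orlicz norm and the modular. -/

theorem orliczNorm_le_of_lintegral_le {Ω E : Type*} [MeasurableSpace Ω] [NormedAddCommGroup E]
    {Ψ : ℝ → ℝ} {μ : Measure Ω} {X : Ω → E} {a : ℝ≥0} (ha : 0 < a)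
    (h : ∫⁻ ω, ENNReal.ofReal (Ψ (‖X ω‖ / a)) ∂μ ≤ 1) : orliczNorm Ψ μ X ≤ a :=
  iInf_le_of_le a (iInf_le_of_le ha (iInf_le_of_le h le_rfl))

/-- The modular decreases in the scale. Strictness of the hypothesis makes it irrelevant whether the
infimum is attained. -/
theorem IsOrliczFunction.lintegral_le_one_of_orliczNorm_lt {Ω E : Type*} [MeasurableSpace Ω]
    [NormedAddCommGroup E] {Ψ : ℝ → ℝ} (hΨ : IsOrliczFunction Ψ) {μ : Measure Ω} {X : Ω → E}
    {b : ℝ≥0} (h : orliczNorm Ψ μ X < b) :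
    ∫⁻ ω, ENNReal.ofReal (Ψ (‖X ω‖ / b)) ∂μ ≤ 1 := by
  simp only [orliczNorm, iInf_lt_iff] at h
  obtain ⟨a, ha, hint, hab⟩ := h
  have hab' : (a : ℝ) ≤ b := by exact_mod_cast hab.le
  have ha' : (0 : ℝ) < a := by exact_mod_cast ha
  refine le_trans (lintegral_mono fun ω => ENNReal.ofReal_le_ofReal (hΨ.mono (by positivity) ?_))
    hint
  gcongr

/-! ### Necessity of (HJ): three-point variables. -/

/-- The symmetric three-point law with mass `p` at each of `u` and `-u`. -/
noncomputable def threePoint (p u : ℝ) : Measure ℝ :=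
  ENNReal.ofReal p • Measure.dirac u + ENNReal.ofReal p • Measure.dirac (-u) +
    ENNReal.ofReal (1 - 2 * p) • Measure.dirac 0

theorem isProbabilityMeasure_threePoint {p u : ℝ} (hp : 0 ≤ p) (hp' : 2 * p ≤ 1) :
    IsProbabilityMeasure (threePoint p u) := by
  constructor
  simp only [threePoint, Measure.add_apply, Measure.smul_apply, measure_univ, smul_eq_mul, mul_one]
  rw [← ENNReal.ofReal_add hp hp, ← ENNReal.ofReal_add (by linarith) (by linarith),
    ← ENNReal.ofReal_one]
  congr 1; ring

theorem lintegral_threePoint {p u : ℝ} (f : ℝ → ℝ≥0∞) :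
    ∫⁻ x, f x ∂threePoint p u =
      ENNReal.ofReal p * f u + ENNReal.ofReal p * f (-u) + ENNReal.ofReal (1 - 2 * p) * f 0 := by
  simp [threePoint, lintegral_add_measure, lintegral_smul_measure]

theorem map_neg_threePoint {p u : ℝ} : (threePoint p u).map Neg.neg = threePoint p u := by
  have h : Measurable (Neg.neg : ℝ → ℝ) := measurable_neg
  simp only [threePoint, Measure.map_add _ _ h, Measure.map_smul, Measure.map_dirac' h, neg_neg,
    neg_zero]
  rw [add_comm (ENNReal.ofReal p • Measure.dirac (-u))]

/-- The map retracting the real line onto `[-u, u]`. -/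
noncomputable def clamp (u x : ℝ) : ℝ := max (-u) (min u x)

theorem measurable_clamp (u : ℝ) : Measurable (clamp u) := by
  unfold clamp; fun_prop

theorem abs_clamp_le {u : ℝ} (hu : 0 ≤ u) (x : ℝ) : |clamp u x| ≤ u :=
  abs_le.2 ⟨le_max_left _ _, max_le (by linarith) (min_le_left _ _)⟩

theorem clamp_neg {u : ℝ} (hu : 0 ≤ u) (x : ℝ) : clamp u (-x) = -clamp u x := by
  unfold clamp
  rcases le_total x u with h1 | h1 <;> rcases le_total (-u) x with h2 | h2 <;>
    grind

theorem clamp_self {u : ℝ} (hu : 0 ≤ u) : clamp u u = u := by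
  unfold clamp; rw [min_self]; exact max_eq_right (by linarith)

theorem clamp_zero {u : ℝ} (hu : 0 ≤ u) : clamp u 0 = 0 := by
  unfold clamp; rw [min_eq_right hu]; exact max_eq_right (by linarith)

/-- The Hoffmann-Jørgensen inequality for sums of symmetric three-point variables bounds the
growth of `Ψ`. -/
theorem orlicz_mul_div_le {Ψ : ℝ → ℝ} (hΨ : IsOrliczFunction Ψ) {D : ℝ≥0}
    (hD : ∀ (Ω : Type) [MeasurableSpace Ω] (μ : Measure Ω) [IsProbabilityMeasure μ]
        (N : ℕ) (X : Fin N → Ω → ℝ),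
        (∀ i, Measurable (X i)) →
        iIndepFun X μ →
        (∀ i j, IdentDistrib (X i) (X j) μ μ) →
        (∀ i, IdentDistrib (X i) (fun ω => -X i ω) μ μ) →
        (∃ M : ℝ, ∀ i ω, |X i ω| ≤ M) →
        HoffmannJorgensenInequality Ψ D μ X)
    {c u : ℝ} (hc : 0 < c) (hc1 : c ≤ 1) (hcΨ : c ≤ Ψ 1) (hu : 1 ≤ u) {k : ℕ} (hk : 0 < k) :
    Ψ (k * u / (2 * D + 1)) ≤ (2 * k * Ψ u / c) ^ k := by
  have hu0 : 0 ≤ u := by linarith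
  have hk0 : (1 : ℝ) ≤ k := by exact_mod_cast hk
  have hΨ1 := hΨ.map_one_pos
  have hΨu : u * Ψ 1 ≤ Ψ u := hΨ.mul_map_one_le hu
  have hΨu1 : Ψ 1 ≤ Ψ u := hΨ.mono zero_le_one hu
  have hΨu0 : 0 < Ψ u := hΨ1.trans_le hΨu1
  -- The expected number of nonzero variables is then `2 k p = c / Ψ u`; with `c ≤ 1` and `c ≤ Ψ 1`
  -- this keeps the modular of the maximum and the mean of the sum at most `1`.
  set p : ℝ := c / Ψ u / (2 * k) with hp
  have hp0 : 0 < p := by positivity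
  have hkp : k * (2 * p) = c / Ψ u := by rw [hp]; field_simp
  have hp1 : 2 * p ≤ 1 := by
    have h1 : c / Ψ u ≤ 1 := (div_le_one hΨu0).2 (hcΨ.trans hΨu1)
    nlinarith
  have : IsProbabilityMeasure (threePoint p u) := isProbabilityMeasure_threePoint hp0.le hp1
  set μ : Measure (Fin k → ℝ) := Measure.pi fun _ => threePoint p u with hμ
  -- Boundedness is required at every `ω`, whereas the coordinates are only almost surely bounded.
  -- Clamping fixes the three atoms and commutes with negation, so law and symmetry survive.
  set X : Fin k → (Fin k → ℝ) → ℝ := fun i ω => clamp u (ω i) with hX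
  have hXm : ∀ i, Measurable (X i) := fun i => (measurable_clamp u).comp (measurable_pi_apply i)
  have heval : ∀ i, μ.map (Function.eval i) = threePoint p u := fun i =>
    (measurePreserving_eval (fun _ : Fin k => threePoint p u) i).map_eq
  have hmap : ∀ i, μ.map (X i) = (threePoint p u).map (clamp u) := fun i => by
    rw [← heval i, Measure.map_map (measurable_clamp u) (measurable_pi_apply i)]; rfl
  have hlint : ∀ (i : Fin k) (f : ℝ → ℝ≥0∞), Measurable f →
      ∫⁻ ω, f (X i ω) ∂μ = ENNReal.ofReal p * f u + ENNReal.ofReal p * f (-u) +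
        ENNReal.ofReal (1 - 2 * p) * f 0 := fun i f hf => by
    rw [← lintegral_map hf (hXm i), hmap, lintegral_map hf (measurable_clamp u),
      lintegral_threePoint, clamp_neg hu0, clamp_self hu0, clamp_zero hu0]
  have hHJ := hD (Fin k → ℝ) μ k X hXm
    (iIndepFun_pi (X := fun _ => clamp u) fun _ => (measurable_clamp u).aemeasurable)
    (fun i j => ⟨(hXm i).aemeasurable, (hXm j).aemeasurable, by rw [hmap, hmap]⟩)
    (fun i => ⟨(hXm i).aemeasurable, (hXm i).neg.aemeasurable, by
      have h1 : (fun ω => -X i ω) = (clamp u ∘ Neg.neg) ∘ Function.eval i := by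
        ext ω; simp [hX, clamp_neg hu0]
      rw [h1, ← Measure.map_map ((measurable_clamp u).comp measurable_neg)
        (measurable_pi_apply i), heval, ← Measure.map_map (measurable_clamp u) measurable_neg,
        map_neg_threePoint, hmap]⟩)
    ⟨u, fun i ω => abs_clamp_le hu0 _⟩
  have hL1 : eLpNorm (fun ω => ∑ i, X i ω) 1 μ ≤ 1 := by
    rw [eLpNorm_one_eq_lintegral_enorm]
    calc ∫⁻ ω, ‖∑ i, X i ω‖ₑ ∂μ ≤ ∫⁻ ω, ∑ i, ‖X i ω‖ₑ ∂μ :=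
          lintegral_mono fun ω => enorm_sum_le _ _
      _ = ∑ i, ∫⁻ ω, ‖X i ω‖ₑ ∂μ :=
          lintegral_finsetSum _ fun i _ => (hXm i).enorm
      _ = ∑ i : Fin k, ENNReal.ofReal (2 * p * u) := by
          refine Finset.sum_congr rfl fun i _ => ?_
          rw [hlint i _ measurable_enorm, enorm_neg, enorm_zero, mul_zero, add_zero,
            Real.enorm_of_nonneg hu0, ← ENNReal.ofReal_mul hp0.le,
            ← ENNReal.ofReal_add (by positivity) (by positivity)]
          congr 1; ring
      _ = ENNReal.ofReal (k * (2 * p) * u) := by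
          rw [Finset.sum_const, Finset.card_univ, Fintype.card_fin, nsmul_eq_mul, mul_assoc (k : ℝ),
            ENNReal.ofReal_mul (p := (k : ℝ)) (by positivity), ENNReal.ofReal_natCast]
      _ ≤ 1 := by
          rw [ENNReal.ofReal_le_one, hkp, div_mul_eq_mul_div, div_le_one hΨu0]
          nlinarith
  have hM : orliczNorm Ψ μ (fun ω => ⨆ i, ‖X i ω‖) ≤ 1 := by
    refine (orliczNorm_le_of_lintegral_le (a := 1) one_pos ?_).trans_eq (by simp)
    have hmeas : Measurable fun x : ℝ => ENNReal.ofReal (Ψ ‖x‖) :=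
      (hΨ.measurable_comp measurable_norm norm_nonneg).ennreal_ofReal
    have : Nonempty (Fin k) := ⟨⟨0, hk⟩⟩
    calc ∫⁻ ω, ENNReal.ofReal (Ψ (‖⨆ i, ‖X i ω‖‖ / (1 : ℝ≥0))) ∂μ
        ≤ ∫⁻ ω, ∑ i, ENNReal.ofReal (Ψ ‖X i ω‖) ∂μ := lintegral_mono fun ω => by
          obtain ⟨i, hi⟩ := exists_eq_ciSup_of_finite (f := fun i => ‖X i ω‖)
          simp only [NNReal.coe_one, div_one, ← hi, norm_norm]
          exact Finset.single_le_sum (f := fun i => ENNReal.ofReal (Ψ ‖X i ω‖))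
            (fun _ _ => zero_le) (Finset.mem_univ i)
      _ = ∑ i, ∫⁻ ω, ENNReal.ofReal (Ψ ‖X i ω‖) ∂μ :=
          lintegral_finsetSum _ fun i _ => hmeas.comp (hXm i)
      _ = ∑ i : Fin k, ENNReal.ofReal (2 * p * Ψ u) := by
          refine Finset.sum_congr rfl fun i _ => ?_
          rw [hlint i _ hmeas, norm_neg, norm_zero, hΨ.map_zero, ENNReal.ofReal_zero, mul_zero,
            add_zero, Real.norm_of_nonneg hu0, ← ENNReal.ofReal_mul hp0.le,
            ← ENNReal.ofReal_add (by positivity) (by positivity)]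
          congr 1; ring
      _ = ENNReal.ofReal (k * (2 * p) * Ψ u) := by
          rw [Finset.sum_const, Finset.card_univ, Fintype.card_fin, nsmul_eq_mul, mul_assoc (k : ℝ),
            ENNReal.ofReal_mul (p := (k : ℝ)) (by positivity), ENNReal.ofReal_natCast]
      _ ≤ 1 := by
          rw [ENNReal.ofReal_le_one, hkp, div_mul_cancel₀ _ hΨu0.ne']
          exact hc1
  -- The inequality gives `2 D`; the extra `1` provides the strictness needed to return to the
  -- modular.
  have hlt : orliczNorm Ψ μ (fun ω => ∑ i, X i ω) < ((2 * D + 1 : ℝ≥0) : ℝ≥0∞) := by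
    calc _ ≤ (D : ℝ≥0∞) * (1 + 1) := hHJ.trans (by gcongr)
      _ = ((D * 2 : ℝ≥0) : ℝ≥0∞) := by push_cast; rw [one_add_one_eq_two]
      _ < _ := by
        rw [ENNReal.coe_lt_coe, mul_comm]
        exact lt_add_one _
  have hint := hΨ.lintegral_le_one_of_orliczNorm_lt hlt
  set A : Set (Fin k → ℝ) := Set.univ.pi fun _ => {u} with hA
  have hAm : MeasurableSet A := MeasurableSet.univ_pi fun _ => measurableSet_singleton u
  have hμA : ENNReal.ofReal (p ^ k) ≤ μ A := by
    rw [hμ, hA, Measure.pi_pi, Finset.prod_const, Finset.card_univ, Fintype.card_fin,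
      ENNReal.ofReal_pow hp0.le]
    gcongr
    simp only [threePoint, Measure.add_apply, Measure.smul_apply, smul_eq_mul, add_assoc]
    refine le_trans ?_ le_self_add
    simp
  have hprod : ENNReal.ofReal (Ψ (k * u / (2 * D + 1))) * ENNReal.ofReal (p ^ k) ≤ 1 := by
    calc _ ≤ ENNReal.ofReal (Ψ (k * u / (2 * D + 1))) * μ A := by gcongr
      _ = ∫⁻ ω in A, ENNReal.ofReal (Ψ (k * u / (2 * D + 1))) ∂μ := (setLIntegral_const _ _).symm
      _ = ∫⁻ ω in A, ENNReal.ofReal (Ψ (‖∑ i, X i ω‖ / (2 * D + 1 : ℝ≥0))) ∂μ := by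
        refine setLIntegral_congr_fun hAm fun ω hω => ?_
        have h1 : ∑ i, X i ω = k * u := by
          rw [Finset.sum_congr rfl fun i _ => show X i ω = u by
            simp only [hX]; rw [show ω i = u from hω i (Set.mem_univ i), clamp_self hu0]]
          simp
        simp only [h1, Real.norm_of_nonneg (by positivity : 0 ≤ (k : ℝ) * u)]
        push_cast
        rfl
      _ ≤ _ := (setLIntegral_le_lintegral _ _).trans hint
  rw [← ENNReal.ofReal_mul (hΨ.nonneg (by positivity)), ENNReal.ofReal_le_one,
    ← le_div_iff₀ (by positivity)] at hprod
  refine hprod.trans_eq ?_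
  rw [one_div, ← inv_pow, hp]
  congr 1
  field_simp

theorem conditionHJ_of_hoffmannJorgensenInequality {Ψ : ℝ → ℝ} (hΨ : IsOrliczFunction Ψ) {D : ℝ≥0}
    (hD : ∀ (Ω : Type) [MeasurableSpace Ω] (μ : Measure Ω) [IsProbabilityMeasure μ]
        (N : ℕ) (X : Fin N → Ω → ℝ),
        (∀ i, Measurable (X i)) →
        iIndepFun X μ →
        (∀ i j, IdentDistrib (X i) (X j) μ μ) →
        (∀ i, IdentDistrib (X i) (fun ω => -X i ω) μ μ) →
        (∃ M : ℝ, ∀ i ω, |X i ω| ≤ M) →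
        HoffmannJorgensenInequality Ψ D μ X) :
    ConditionHJ Ψ := by
  have hΨ1 := hΨ.map_one_pos
  set c : ℝ := min 1 (Ψ 1) with hc
  have hc0 : 0 < c := lt_min one_pos hΨ1
  set D' : ℝ := 2 * D + 1 with hD'
  have hD'1 : 1 ≤ D' := by rw [hD']; linarith [D.coe_nonneg]
  set R : ℝ := 2 * (D' + 1) / c with hR
  have hR0 : 0 ≤ R := by positivity
  have hK1 : 1 ≤ (D' + 1) * (1 + 2 * R) := by nlinarith
  -- `D' + 1` comes from `k ≤ (D' + 1) s` and `1 + 2 R` from bounding `log(1 + 2 k / c)` by a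
  -- multiple of `log(1 + s)`.
  refine ⟨(D' + 1) * (1 + 2 * R), by positivity, fun s u hs hu => ?_⟩
  have hs1 : 1 ≤ s := hK1.trans hs
  have hu1 : 1 ≤ u := hK1.trans hu
  have hu0 : 0 ≤ u := by linarith
  set k : ℕ := ⌈D' * s⌉₊ with hk
  have hks : D' * s ≤ k := Nat.le_ceil _
  have hks' : (k : ℝ) ≤ (D' + 1) * s := by
    have := Nat.ceil_lt_add_one (a := D' * s) (by positivity)
    rw [← hk] at this
    linarith
  have hk0 : 0 < k := Nat.ceil_pos.2 (by positivity)
  have hψu := hΨ.exponent_nonneg hu0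
  have hbound := orlicz_mul_div_le hΨ hD hc0 (min_le_left _ _) (min_le_right _ _) hu1 hk0
  rw [← hD'] at hbound
  have hΨu := hΨ.nonneg hu0
  have hexp : 1 + Ψ (k * u / D') ≤ ((1 + 2 * k / c) * (1 + Ψ u)) ^ k := by
    have h2 : 1 + (2 * k * Ψ u / c) ^ k ≤ (1 + 2 * k * Ψ u / c) ^ k := by
      have := pow_add_pow_le (x := (1 : ℝ)) (y := 2 * k * Ψ u / c) zero_le_one (by positivity) hk0.ne'
      simpa using this
    refine (by linarith : 1 + Ψ (k * u / D') ≤ (1 + 2 * k * Ψ u / c) ^ k).trans ?_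
    gcongr
    have h3 : 0 ≤ 2 * k / c := by positivity
    have h4 : 2 * k * Ψ u / c = 2 * k / c * Ψ u := by ring
    rw [h4]
    nlinarith
  have hlogb : Real.log (1 + 2 * k / c) ≤ (1 + 2 * R) * Real.log (1 + s) := by
    have hle : 1 + 2 * k / c ≤ (1 + s) * (1 + R) := by
      have : 2 * k / c ≤ R * s := by
        rw [hR, div_mul_eq_mul_div, mul_assoc]
        gcongr
      nlinarith
    have h1 : Real.log (1 + 2 * k / c) ≤ Real.log (1 + s) + Real.log (1 + R) := by
      rw [← Real.log_mul (by positivity) (by positivity)]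
      exact Real.log_le_log (by positivity) hle
    have h2 : Real.log (1 + R) ≤ R := by
      have := Real.log_le_sub_one_of_pos (by positivity : 0 < 1 + R)
      linarith
    -- Since `s ≥ 1`, the additive constant `R` is absorbed as `R ≤ 2 R log(1 + s)`.
    have h3 : 1 / 2 ≤ Real.log (1 + s) := by
      have := Real.log_two_gt_d9
      have := Real.log_le_log two_pos (by linarith : 2 ≤ 1 + s)
      linarith
    nlinarith
  calc orliczExponent Ψ (s * u) ≤ orliczExponent Ψ (k * u / D') := by
        refine hΨ.exponent_mono (by positivity) ?_
        rw [le_div_iff₀ (by positivity)]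
        nlinarith
    _ ≤ Real.log (((1 + 2 * k / c) * (1 + Ψ u)) ^ k) :=
        Real.log_le_log (by linarith [hΨ.nonneg (by positivity : 0 ≤ k * u / D')]) hexp
    _ = k * (Real.log (1 + 2 * k / c) + orliczExponent Ψ u) := by
        rw [Real.log_pow, Real.log_mul (by positivity) (by positivity)]; rfl
    _ ≤ (D' + 1) * s * ((1 + 2 * R) * Real.log (1 + s) + (1 + 2 * R) * orliczExponent Ψ u) := by
        have hl0 : 0 ≤ Real.log (1 + 2 * k / c) := Real.log_nonneg (by
          have : 0 ≤ 2 * k / c := by positivity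
          linarith)
        gcongr
        nlinarith
    _ = _ := by ring

/-! ### Renewal recursions and factorial bounds. -/

/-- Abel summation: domination of partial sums gives domination of sums against an antitone
nonnegative weight. -/
theorem sum_mul_le_sum_mul_of_partialSums_le {p q f : ℕ → ℝ} {n : ℕ}
    (hpq : ∀ m ≤ n, ∑ j ∈ Finset.range m, p j ≤ ∑ j ∈ Finset.range m, q j)
    (hf : ∀ j < n, 0 ≤ f j) (hanti : ∀ j, j + 1 < n → f (j + 1) ≤ f j) :
    ∑ j ∈ Finset.range n, p j * f j ≤ ∑ j ∈ Finset.range n, q j * f j := by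
  have key : ∀ m, m + 1 ≤ n → f m * ∑ j ∈ Finset.range (m + 1), (q j - p j) ≤
      ∑ j ∈ Finset.range (m + 1), (q j - p j) * f j := by
    intro m
    induction m with
    | zero => intro _; simp [mul_comm]
    | succ m ih =>
      intro hm
      rw [Finset.sum_range_succ, Finset.sum_range_succ _ (m + 1)]
      have h1 := ih (by omega)
      have h2 : 0 ≤ ∑ j ∈ Finset.range (m + 1), (q j - p j) := by
        rw [Finset.sum_sub_distrib]; linarith [hpq (m + 1) (by omega)]
      have h3 := hanti m (by omega)
      nlinarith
  rcases n with _ | n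
  · simp
  · have h1 := key n le_rfl
    have h2 : 0 ≤ ∑ j ∈ Finset.range (n + 1), (q j - p j) := by
      rw [Finset.sum_sub_distrib]; linarith [hpq (n + 1) le_rfl]
    have h3 := mul_nonneg (hf n (by omega)) h2
    have h4 : ∑ j ∈ Finset.range (n + 1), (q j - p j) * f j =
        ∑ j ∈ Finset.range (n + 1), q j * f j - ∑ j ∈ Finset.range (n + 1), p j * f j := by
      rw [← Finset.sum_sub_distrib]; exact Finset.sum_congr rfl fun _ _ => by ring
    linarith

/-- A lower Riemann rectangle for the integral of `z ^ k` over `[y, x]`: each of the `k + 1` terms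
of `(x ^ (k + 1) - y ^ (k + 1)) / (x - y)` is at least `y ^ k`. -/
theorem sub_mul_pow_le {x y : ℝ} (hy : 0 ≤ y) (hyx : y ≤ x) (k : ℕ) :
    (x - y) * y ^ k ≤ (x ^ (k + 1) - y ^ (k + 1)) / (k + 1) := by
  rw [le_div_iff₀ (by positivity), ← geom_sum₂_mul x y (k + 1),
    mul_comm _ (x - y), mul_assoc]
  refine mul_le_mul_of_nonneg_left ?_ (by linarith)
  calc y ^ k * (k + 1) = ∑ i ∈ Finset.range (k + 1), y ^ k := by
        rw [Finset.sum_const, Finset.card_range, nsmul_eq_mul]; push_cast; ring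
    _ ≤ _ := Finset.sum_le_sum fun i hi => by
        have : i + (k + 1 - 1 - i) = k := by have := Finset.mem_range.1 hi; omega
        calc y ^ k = y ^ i * y ^ (k + 1 - 1 - i) := by rw [← pow_add, this]
          _ ≤ _ := by gcongr

/-- A renewal-type recursion whose transition weights are dominated by the increments of `h` is
dominated by the Poisson-type bound `(h N - h m) ^ k / k!`. -/
theorem renewal_bound {N : ℕ} {h : ℕ → ℝ} (hmono : Monotone h) {p : ℕ → ℕ → ℝ}
    (hp0 : ∀ m j, 0 ≤ p m j)
    (hp : ∀ m n, m ≤ n → n ≤ N → ∑ j ∈ Finset.Ioc m n, p m j ≤ h n - h m)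
    {a : ℕ → ℕ → ℝ} (ha0 : ∀ m, a 0 m ≤ 1)
    (ha : ∀ k m, m ≤ N → a (k + 1) m ≤ ∑ j ∈ Finset.Ioc m N, p m j * a k j) (k m : ℕ)
    (hm : m ≤ N) : a k m ≤ (h N - h m) ^ k / k.factorial := by
  induction k generalizing m with
  | zero => simpa using ha0 m
  | succ k ih =>
    obtain ⟨L, rfl⟩ := Nat.exists_eq_add_of_le hm
    have hIoc : ∀ (f : ℕ → ℝ) (n : ℕ), ∑ j ∈ Finset.Ioc m (m + n), f j =
        ∑ j ∈ Finset.range n, f (m + j + 1) := by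
      intro f n
      induction n with
      | zero => simp
      | succ n ihn =>
        rw [← add_assoc, ← Finset.insert_Ioc_right_eq_Ioc_add_one (by omega),
          Finset.sum_insert (by simp), ihn, Finset.sum_range_succ, add_comm]
    set H := h (m + L) with hH
    have hHj : ∀ j ≤ m + L, 0 ≤ H - h j := fun j hj => sub_nonneg.2 (hmono hj)
    calc a (k + 1) m ≤ ∑ j ∈ Finset.Ioc m (m + L), p m j * a k j := ha k m hm
      _ ≤ ∑ j ∈ Finset.Ioc m (m + L), p m j * ((H - h j) ^ k / k.factorial) :=
        Finset.sum_le_sum fun j hj =>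
          mul_le_mul_of_nonneg_left (ih j (Finset.mem_Ioc.1 hj).2) (hp0 m j)
      _ = ∑ j ∈ Finset.range L, p m (m + j + 1) * ((H - h (m + j + 1)) ^ k / k.factorial) :=
        hIoc _ _
      -- The weight `(H - h j) ^ k / k!` is antitone in `j`, so Abel summation replaces the
      -- transition weights by increments of `h`. What remains is a lower Riemann sum, bounded by a
      -- telescoping sum; this integration produces the new factor `1 / (k + 1)`.
      _ ≤ ∑ j ∈ Finset.range L, (h (m + j + 1) - h (m + j)) *
            ((H - h (m + j + 1)) ^ k / k.factorial) := by
        refine sum_mul_le_sum_mul_of_partialSums_le (p := fun j => p m (m + j + 1))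
          (q := fun j => h (m + j + 1) - h (m + j))
          (f := fun j => (H - h (m + j + 1)) ^ k / k.factorial) (fun n hn => ?_)
          (fun j hj => ?_) fun j hj => ?_
        · have h1 := Finset.sum_range_sub (fun j => h (m + j)) n
          simp only [← add_assoc, add_zero] at h1
          rw [h1, ← hIoc]
          exact hp m (m + n) (by omega) (by omega)
        · have := hHj (m + j + 1) (by omega)
          positivity
        · have := hHj (m + (j + 1) + 1) (by omega)
          have := hmono (show m + j + 1 ≤ m + (j + 1) + 1 by omega)
          gcongr
      _ ≤ ∑ j ∈ Finset.range L, ((H - h (m + j)) ^ (k + 1) - (H - h (m + j + 1)) ^ (k + 1)) /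
            (k + 1) / k.factorial := Finset.sum_le_sum fun j hj => by
        have hj := Finset.mem_range.1 hj
        have := sub_mul_pow_le (hHj (m + j + 1) (by omega))
          (sub_le_sub_left (hmono (show m + j ≤ m + j + 1 by omega)) H) k
        rw [mul_div_assoc']
        gcongr
        linarith
      _ = (H - h m) ^ (k + 1) / (k + 1).factorial := by
        have h1 := Finset.sum_range_sub' (fun j => (H - h (m + j)) ^ (k + 1)) L
        simp only [← add_assoc, add_zero] at h1
        rw [← Finset.sum_div, ← Finset.sum_div, h1]
        simp only [ ← hH, sub_self, ne_eq, Nat.succ_ne_zero, not_false_eq_true, zero_pow,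
          sub_zero]
        rw [div_div, Nat.factorial_succ]
        push_cast
        rfl

/-- The first two terms of the binomial expansion; this is the step of adjoining one index in the
bound on elementary symmetric functions. -/
theorem pow_succ_add_mul_pow_le (x y : ℝ≥0∞) (n : ℕ) :
    x ^ (n + 1) + (n + 1) * (y * x ^ n) ≤ (x + y) ^ (n + 1) := by
  induction n with
  | zero => simp
  | succ n ih =>
    calc x ^ (n + 1 + 1) + ((n + 1 : ℕ) + 1) * (y * x ^ (n + 1))
        = (x ^ (n + 1) + (n + 1) * (y * x ^ n)) * x + x ^ (n + 1) * y := by push_cast; ring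
      _ ≤ (x + y) ^ (n + 1) * x + (x + y) ^ (n + 1) * y := by
        gcongr
        exact le_self_add
      _ = (x + y) ^ (n + 1 + 1) := by ring

/-- Elementary symmetric functions are bounded by powers of the sum. -/
theorem factorial_mul_sum_powersetCard_prod_le {ι : Type*} (s : Finset ι) (w : ι → ℝ≥0∞) (n : ℕ) :
    (n.factorial : ℝ≥0∞) * ∑ J ∈ s.powersetCard n, ∏ i ∈ J, w i ≤ (∑ i ∈ s, w i) ^ n := by
  classical
  induction s using Finset.induction_on generalizing n with
  | empty => rcases n with _ | n <;> simp
  | insert a s has ih =>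
    rcases n with _ | n
    · simp
    · rw [Finset.powersetCard_succ_insert has, Finset.sum_union, Finset.sum_image,
        Finset.sum_insert has, mul_add, add_comm (w a)]
      · refine le_trans (add_le_add (ih (n + 1)) ?_) (pow_succ_add_mul_pow_le _ _ n)
        have : ∀ J ∈ s.powersetCard n, ∏ i ∈ insert a J, w i = w a * ∏ i ∈ J, w i :=
          fun J hJ => Finset.prod_insert fun h => has ((Finset.mem_powersetCard.1 hJ).1 h)
        rw [Finset.sum_congr rfl this, ← Finset.mul_sum, Nat.factorial_succ]
        push_cast
        calc _ = (n + 1) * (w a * (n.factorial * ∑ J ∈ s.powersetCard n, ∏ i ∈ J, w i)) := by ring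
          _ ≤ _ := by gcongr; exact ih n
      · intro J hJ J' hJ' h
        have h1 : a ∉ J := fun h => has ((Finset.mem_powersetCard.1 hJ).1 h)
        have h2 : a ∉ J' := fun h => has ((Finset.mem_powersetCard.1 hJ').1 h)
        simpa [Finset.erase_insert h1, Finset.erase_insert h2] using congrArg (Finset.erase · a) h
      · rw [Finset.disjoint_left]
        intro J hJ hJ'
        obtain ⟨J', -, rfl⟩ := Finset.mem_image.1 hJ'
        exact has ((Finset.mem_powersetCard.1 hJ).1 (Finset.mem_insert_self a J'))

theorem natCast_pow_le_three_pow_mul_factorial (n : ℕ) :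
    (n : ℝ) ^ n ≤ 3 ^ n * n.factorial := by
  have h1 := Real.pow_div_factorial_le_exp (n : ℝ) (Nat.cast_nonneg n) n
  rw [div_le_iff₀ (by positivity)] at h1
  refine h1.trans ?_
  have : Real.exp n = Real.exp 1 ^ n := by rw [← Real.exp_nat_mul, mul_one]
  rw [this]
  gcongr
  linarith [Real.exp_one_lt_d9]

/-- Trades the entropy factor for `n!`, which the `1 / n!` in the exit probabilities and in the
elementary symmetric functions then cancels. -/
theorem one_add_two_mul_pow_le (n : ℕ) :
    (1 + 2 * (n : ℝ)) ^ n ≤ 9 ^ n * n.factorial := by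
  rcases n with _ | n
  · simp
  · calc (1 + 2 * ((n + 1 : ℕ) : ℝ)) ^ (n + 1) ≤ (3 * ((n + 1 : ℕ) : ℝ)) ^ (n + 1) := by
          gcongr
          push_cast
          linarith [Nat.cast_nonneg (α := ℝ) n]
      _ = 3 ^ (n + 1) * ((n + 1 : ℕ) : ℝ) ^ (n + 1) := mul_pow _ _ _
      _ ≤ 3 ^ (n + 1) * (3 ^ (n + 1) * (n + 1).factorial) := by
          gcongr; exact natCast_pow_le_three_pow_mul_factorial (n + 1)
      _ = 9 ^ (n + 1) * (n + 1).factorial := by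
          rw [← mul_assoc, ← mul_pow]; norm_num

/-! ### The walk of partial sums and its successive exits. -/

section WindowSigma

variable {Ω F : Type*} [MeasurableSpace F] {N : ℕ}

/-- The σ-algebra generated by the `X i` with `m ≤ i < n`. -/
abbrev windowSigma (X : Fin N → Ω → F) (m n : ℕ) : MeasurableSpace Ω :=
  ⨆ i ∈ {i : Fin N | m ≤ i.val ∧ i.val < n}, MeasurableSpace.comap (X i) inferInstance

theorem windowSigma_le [mΩ : MeasurableSpace Ω] {X : Fin N → Ω → F} (hX : ∀ i, Measurable (X i))
    (m n : ℕ) : windowSigma X m n ≤ mΩ :=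
  iSup₂_le fun i _ => (hX i).comap_le

theorem indep_windowSigma [MeasurableSpace Ω] {μ : Measure Ω} {X : Fin N → Ω → F}
    (hX : ∀ i, Measurable (X i)) (hind : iIndepFun X μ) (l m n : ℕ) :
    Indep (windowSigma X l m) (windowSigma X m n) μ := by
  refine indep_iSup_of_disjoint (fun i => (hX i).comap_le) hind ?_
  rw [Set.disjoint_left]
  intro i h1 h2
  exact absurd h1.2 (not_lt.2 h2.1)

theorem windowSigma_mono (X : Fin N → Ω → F) {m m' n n' : ℕ} (hm : m' ≤ m) (hn : n ≤ n') :
    windowSigma X m n ≤ windowSigma X m' n' :=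
  biSup_mono fun _ hi => ⟨hm.trans hi.1, hi.2.trans_le hn⟩

end WindowSigma

section Walk

variable {Ω F : Type*} [NormedAddCommGroup F] {N : ℕ}

/-- The sum of the `X i` over `m ≤ i < n`. -/
def windowSum (X : Fin N → Ω → F) (m n : ℕ) (ω : Ω) : F :=
  ∑ i : Fin N with m ≤ i.val ∧ i.val < n, X i ω

theorem windowSum_self (X : Fin N → Ω → F) (m : ℕ) (ω : Ω) : windowSum X m m ω = 0 := by
  rw [windowSum, Finset.filter_false_of_mem fun i _ => by omega, Finset.sum_empty]

theorem windowSum_zero_card (X : Fin N → Ω → F) (ω : Ω) : windowSum X 0 N ω = ∑ i, X i ω := by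
  rw [windowSum, Finset.filter_true_of_mem fun i _ => ⟨Nat.zero_le _, i.2⟩]

theorem windowSum_add (X : Fin N → Ω → F) {l m n : ℕ} (hlm : l ≤ m) (hmn : m ≤ n) (ω : Ω) :
    windowSum X l m ω + windowSum X m n ω = windowSum X l n ω := by
  rw [windowSum, windowSum, windowSum, ← Finset.sum_union]
  · congr 1
    ext i
    simp only [Finset.mem_union, Finset.mem_filter, Finset.mem_univ, true_and]
    omega
  · rw [Finset.disjoint_filter]
    intro i _ h1 h2
    omega

theorem windowSum_succ (X : Fin N → Ω → F) (i : Fin N) (ω : Ω) :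
    windowSum X i (i + 1) ω = X i ω := by
  rw [windowSum, Finset.sum_eq_single_of_mem i (by simp)]
  intro j hj hji
  have := (Finset.mem_filter.1 hj).2
  exact absurd (Fin.ext (by omega)) hji

/-- The event that `j` is the first time at which the walk restarted at time `m` leaves the ball of
radius `t`. -/
def firstExit (X : Fin N → Ω → F) (t : ℝ) (m j : ℕ) : Set Ω :=
  {ω | t < ‖windowSum X m j ω‖ ∧ ∀ l, m ≤ l → l < j → ‖windowSum X m l ω‖ ≤ t}

/-- The event that the walk, restarted at time `m` and after each exit from the ball of radius `t`
around its last starting point, has at least `k` exits. -/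
def multiExit (X : Fin N → Ω → F) (t : ℝ) : ℕ → ℕ → Set Ω
  | 0, _ => Set.univ
  | k + 1, m => ⋃ j ∈ Finset.Ioc m N, firstExit X t m j ∩ multiExit X t k j

/-- The event that the walk stays in the ball of radius `t` between times `m` and `n`. -/
def staysIn (X : Fin N → Ω → F) (t : ℝ) (m n : ℕ) : Set Ω :=
  {ω | ∀ l, m ≤ l → l ≤ n → ‖windowSum X m l ω‖ ≤ t}

theorem firstExit_disjoint (X : Fin N → Ω → F) (t : ℝ) {m j j' : ℕ} (hj : m ≤ j) (hj' : m ≤ j')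
    (h : j ≠ j') : Disjoint (firstExit X t m j) (firstExit X t m j') := by
  rw [Set.disjoint_left]
  intro ω h1 h2
  rcases h.lt_or_gt with h3 | h3
  · exact absurd (h2.2 j hj h3) (not_le.2 h1.1)
  · exact absurd (h1.2 j' hj' h3) (not_le.2 h2.1)

theorem compl_staysIn (X : Fin N → Ω → F) {t : ℝ} (ht : 0 ≤ t) (m n : ℕ) :
    (staysIn X t m n)ᶜ = ⋃ j ∈ Finset.Ioc m n, firstExit X t m j := by
  classical
  ext ω
  simp only [Set.mem_compl_iff, staysIn, Set.mem_ofPred_eq, Set.mem_iUnion, Finset.mem_Ioc,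
    exists_prop]
  constructor
  · intro h
    push Not at h
    have h' : ∃ l, m ≤ l ∧ l ≤ n ∧ t < ‖windowSum X m l ω‖ := h
    obtain ⟨h1, h2, h3⟩ := Nat.find_spec h'
    refine ⟨Nat.find h', ⟨lt_of_le_of_ne h1 fun h0 => ?_, h2⟩, h3, fun l hml hl => ?_⟩
    · rw [← h0, windowSum_self, norm_zero] at h3
      linarith
    · have := Nat.find_min h' hl
      push Not at this
      exact this hml (by omega)
  · rintro ⟨j, ⟨hmj, hjn⟩, hj, -⟩ h
    exact absurd (h j hmj.le hjn) (not_le.2 hj)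

/-- Every exit consumes at least one step, so the number of exits is finite and can be selected
pointwise. -/
theorem multiExit_eq_empty (X : Fin N → Ω → F) (t : ℝ) {k m : ℕ} (h : N < k + m) (hm : m ≤ N) :
    multiExit X t k m = ∅ := by
  induction k generalizing m with
  | zero => omega
  | succ k ih =>
    simp only [multiExit, Set.iUnion_eq_empty]
    intro j hj
    obtain ⟨h1, h2⟩ := Finset.mem_Ioc.1 hj
    rw [ih (by omega) h2, Set.inter_empty]

/-- A walk with fewer than `k` exits is bounded by `2 k t` up to the contribution of the large
steps. -/
theorem norm_windowSum_le_of_notMem_multiExit (X : Fin N → Ω → F) {t : ℝ} (ht : 0 ≤ t) {k m : ℕ}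
    (hm : m ≤ N) {ω : Ω} (h : ω ∉ multiExit X t k m) :
    ‖windowSum X m N ω‖ ≤
      2 * k * t + ∑ i : Fin N with m ≤ i.val ∧ t < ‖X i ω‖, ‖X i ω‖ := by
  induction k generalizing m with
  | zero => exact absurd (Set.mem_univ ω) h
  | succ k ih =>
    have hB : 0 ≤ ∑ i : Fin N with m ≤ i.val ∧ t < ‖X i ω‖, ‖X i ω‖ :=
      Finset.sum_nonneg fun _ _ => norm_nonneg _
    by_cases hs : ω ∈ staysIn X t m N
    · have h1 := hs N hm le_rfl
      have h2 : 0 ≤ (k : ℝ) * t := by positivity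
      push_cast
      linarith
    · rw [← Set.mem_compl_iff, compl_staysIn X ht] at hs
      simp only [Set.mem_iUnion, exists_prop] at hs
      obtain ⟨j, hj, hexit⟩ := hs
      obtain ⟨hmj, hjN⟩ := Finset.mem_Ioc.1 hj
      have hk : ω ∉ multiExit X t k j := fun hk => h (Set.mem_biUnion hj ⟨hexit, hk⟩)
      have h1 := ih hjN hk
      -- The partial sum at time `j` involves indices below `j`, so the exit at `j` is caused by the
      -- step `j - 1`. The position before it costs `t`; the step itself costs another `t` or is
      -- charged to the large steps, and it precedes all those charged after the restart.
      set i : Fin N := ⟨j - 1, by omega⟩ with hi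
      have hiv : i.val = j - 1 := rfl
      have hij : i.val + 1 = j := by omega
      have h2 : windowSum X m N ω = windowSum X m i ω + X i ω + windowSum X j N ω := by
        rw [← windowSum_succ X i ω, windowSum_add X (by omega) (by omega), hij,
          windowSum_add X hmj.le hjN]
      have h3 : ‖windowSum X m i ω‖ ≤ t := hexit.2 i (by omega) (by omega)
      have h4 : ‖X i ω‖ + ∑ i : Fin N with j ≤ i.val ∧ t < ‖X i ω‖, ‖X i ω‖ ≤
          t + ∑ i : Fin N with m ≤ i.val ∧ t < ‖X i ω‖, ‖X i ω‖ := by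
        by_cases hit : t < ‖X i ω‖
        · rw [← Finset.sum_insert (f := fun i => ‖X i ω‖) (a := i) (by simp; omega)]
          refine (Finset.sum_le_sum_of_subset_of_nonneg ?_ fun _ _ _ => norm_nonneg _).trans
            (le_add_of_nonneg_left ht)
          intro l hl
          rcases Finset.mem_insert.1 hl with rfl | hl
          · simp [hit]; omega
          · have := (Finset.mem_filter.1 hl).2
            exact Finset.mem_filter.2 ⟨Finset.mem_univ _, by omega, this.2⟩
        · refine add_le_add (not_lt.1 hit)
            (Finset.sum_le_sum_of_subset_of_nonneg ?_ fun _ _ _ => norm_nonneg _)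
          intro l hl
          have := (Finset.mem_filter.1 hl).2
          exact Finset.mem_filter.2 ⟨Finset.mem_univ _, by omega, this.2⟩
      calc ‖windowSum X m N ω‖ ≤ ‖windowSum X m i ω‖ + ‖X i ω‖ + ‖windowSum X j N ω‖ := by
            rw [h2]; exact norm_add₃_le
        _ ≤ _ := by push_cast; linarith

section Measurability

variable [MeasurableSpace F]

variable [BorelSpace F] [SecondCountableTopology F]

theorem measurable_windowSum (X : Fin N → Ω → F) {m n l l' : ℕ} (hl : m ≤ l) (hl' : l' ≤ n) :
    Measurable[windowSigma X m n] (windowSum X l l') := by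
  refine @Finset.measurable_fun_sum _ _ _ _ _ _ (windowSigma X m n) _ _ fun i hi => ?_
  have := (Finset.mem_filter.1 hi).2
  exact Measurable.mono (comap_measurable (X i))
    (le_iSup₂_of_le i ⟨by omega, by omega⟩ le_rfl) le_rfl

theorem measurableSet_firstExit (X : Fin N → Ω → F) (t : ℝ) {m j n : ℕ} (hj : j ≤ n) :
    MeasurableSet[windowSigma X m n] (firstExit X t m j) := by
  let _ := windowSigma X m n
  have h : firstExit X t m j = {ω | t < ‖windowSum X m j ω‖} ∩
      ⋂ l, ⋂ (_ : m ≤ l), ⋂ (_ : l < j), {ω | ‖windowSum X m l ω‖ ≤ t} := by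
    ext ω; simp [firstExit]
  rw [h]
  refine MeasurableSet.inter (measurableSet_lt measurable_const
    (measurable_windowSum X le_rfl hj).norm) ?_
  exact MeasurableSet.iInter fun l => MeasurableSet.iInter fun hl => MeasurableSet.iInter fun hl' =>
    measurableSet_le (measurable_windowSum X le_rfl (by omega)).norm measurable_const

theorem measurableSet_staysIn (X : Fin N → Ω → F) (t : ℝ) (m n : ℕ) :
    MeasurableSet[windowSigma X m n] (staysIn X t m n) := by
  let _ := windowSigma X m n
  simp only [staysIn, Set.ofPred_forall]
  exact MeasurableSet.iInter fun l => MeasurableSet.iInter fun hl => MeasurableSet.iInter fun hl' =>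
    measurableSet_le (measurable_windowSum X le_rfl hl').norm measurable_const

theorem measurableSet_multiExit (X : Fin N → Ω → F) (t : ℝ) (k m : ℕ) :
    MeasurableSet[windowSigma X m N] (multiExit X t k m) := by
  induction k generalizing m with
  | zero => exact @MeasurableSet.univ _ (windowSigma X m N)
  | succ k ih =>
    refine @Finset.measurableSet_biUnion _ _ (windowSigma X m N) _ _ fun j hj => ?_
    obtain ⟨h1, h2⟩ := Finset.mem_Ioc.1 hj
    exact @MeasurableSet.inter _ (windowSigma X m N) _ _ (measurableSet_firstExit X t h2)
      (windowSigma_mono X h1.le le_rfl _ (ih j))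

end Measurability

end Walk

/-! ### Maximal inequality and the tail of the number of exits. -/

/-- Adding an independent centred variable increases the mean norm on any event of the past. -/
theorem setLIntegral_enorm_le_setLIntegral_enorm_add {Ω F : Type*} [NormedAddCommGroup F]
    [NormedSpace ℝ F] [CompleteSpace F] [MeasurableSpace F] [BorelSpace F]
    [SecondCountableTopology F] {σ₁ σ₂ : MeasurableSpace Ω} [mΩ : MeasurableSpace Ω] {μ : Measure Ω}
    [IsProbabilityMeasure μ] (h₁ : σ₁ ≤ mΩ) (h₂ : σ₂ ≤ mΩ) (hind : Indep σ₁ σ₂ μ) {A : Set Ω}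
    (hA : MeasurableSet[σ₁] A) {Y V : Ω → F} (hY : Measurable[σ₁] Y) (hV : Measurable[σ₂] V)
    (hVi : Integrable V μ) (hV0 : ∫ ω, V ω ∂μ = 0) :
    ∫⁻ ω in A, ‖Y ω‖ₑ ∂μ ≤ ∫⁻ ω in A, ‖Y ω + V ω‖ₑ ∂μ := by
  -- Pairing `Y` with the indicator of `A` makes the joint law with `V` a product; Fubini then
  -- reduces the claim to `‖y‖ ≤ E ‖y + V‖` for fixed `y`.
  set W : Ω → ℝ≥0∞ × F := fun ω => (A.indicator (fun _ => 1) ω, Y ω) with hW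
  have hWm : Measurable[σ₁] W :=
    Measurable.prodMk (Measurable.indicator (@measurable_const _ _ _ σ₁ _) hA) hY
  have hWm' : Measurable W := hWm.mono h₁ le_rfl
  have hVm' : Measurable V := hV.mono h₂ le_rfl
  have hWV : IndepFun W V μ :=
    (IndepFun_iff_Indep W V μ).2
      (indep_of_indep_of_le_left (indep_of_indep_of_le_right hind hV.comap_le) hWm.comap_le)
  have hmap := (indepFun_iff_map_prod_eq_prod_map_map hWm'.aemeasurable hVm'.aemeasurable).1 hWV
  have : IsProbabilityMeasure (μ.map V) := Measure.isProbabilityMeasure_map hVm'.aemeasurable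
  have hφ : Measurable fun z : (ℝ≥0∞ × F) × F => z.1.1 * ‖z.1.2 + z.2‖ₑ := by fun_prop
  have hν : Integrable (fun v : F => v) (μ.map V) :=
    (integrable_map_measure aestronglyMeasurable_id hVm'.aemeasurable).2 hVi
  have hν0 : ∫ v, v ∂(μ.map V) = 0 := by
    exact (integral_map hVm'.aemeasurable aestronglyMeasurable_id).trans hV0
  have hinner : ∀ y : F, ‖y‖ₑ ≤ ∫⁻ v, ‖y + v‖ₑ ∂(μ.map V) := fun y => by
    have h1 : ∫ v, (y + v) ∂(μ.map V) = y := by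
      rw [integral_add (integrable_const y) hν, hν0]; simp
    calc ‖y‖ₑ = ‖∫ v, (y + v) ∂(μ.map V)‖ₑ := by rw [h1]
      _ ≤ _ := enorm_integral_le_lintegral_enorm _
  have hind' : ∀ f : Ω → ℝ≥0∞, ∫⁻ ω in A, f ω ∂μ = ∫⁻ ω, A.indicator (fun _ => 1) ω * f ω ∂μ := fun f => by
    rw [← lintegral_indicator (h₁ A hA)]
    refine lintegral_congr fun ω => ?_
    by_cases h : ω ∈ A <;> simp [h]
  rw [hind', hind']
  calc ∫⁻ ω, A.indicator (fun _ => 1) ω * ‖Y ω‖ₑ ∂μ = ∫⁻ w, w.1 * ‖w.2‖ₑ ∂(μ.map W) := by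
        rw [lintegral_map (by fun_prop) hWm']
    _ ≤ ∫⁻ w, ∫⁻ v, w.1 * ‖w.2 + v‖ₑ ∂(μ.map V) ∂(μ.map W) := by
        refine lintegral_mono fun w => ?_
        rw [lintegral_const_mul _ (by fun_prop)]
        gcongr
        exact hinner _
    _ = ∫⁻ z, z.1.1 * ‖z.1.2 + z.2‖ₑ ∂((μ.map W).prod (μ.map V)) :=
        (lintegral_prod _ hφ.aemeasurable).symm
    _ = ∫⁻ ω, A.indicator (fun _ => 1) ω * ‖Y ω + V ω‖ₑ ∂μ := by
        rw [← hmap, lintegral_map hφ (hWm'.prodMk hVm')]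

section WalkProbability

variable {Ω F : Type*} [MeasurableSpace Ω] {μ : Measure Ω} [IsProbabilityMeasure μ]
  [NormedAddCommGroup F] [MeasurableSpace F] [BorelSpace F] [SecondCountableTopology F]
  {N : ℕ} {X : Fin N → Ω → F}

theorem measureReal_compl_staysIn (hX : ∀ i, Measurable (X i)) {t : ℝ} (ht : 0 ≤ t) (m n : ℕ) :
    μ.real (staysIn X t m n)ᶜ = ∑ j ∈ Finset.Ioc m n, μ.real (firstExit X t m j) := by
  rw [compl_staysIn X ht, measureReal_biUnion_finset]
  · intro j hj j' hj' h
    exact firstExit_disjoint X t (Finset.mem_Ioc.1 hj).1.le (Finset.mem_Ioc.1 hj').1.le h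
  · exact fun j _ => windowSigma_le hX m j _ (measurableSet_firstExit X t le_rfl)

/-- Doob's maximal inequality for sums of independent centred vectors. -/
theorem mul_measure_compl_staysIn_le [NormedSpace ℝ F] [CompleteSpace F]
    (hX : ∀ i, Measurable (X i)) (hind : iIndepFun X μ) (hint : ∀ i, Integrable (X i) μ)
    (hmean : ∀ i, ∫ ω, X i ω ∂μ = 0) {t : ℝ} (ht : 0 ≤ t) :
    ENNReal.ofReal t * μ (staysIn X t 0 N)ᶜ ≤ ∫⁻ ω, ‖∑ i, X i ω‖ₑ ∂μ := by
  have hm : ∀ j ∈ Finset.Ioc 0 N, MeasurableSet (firstExit X t 0 j) := fun j _ =>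
    windowSigma_le hX 0 j _ (measurableSet_firstExit X t le_rfl)
  have hdisj : (Finset.Ioc 0 N : Set ℕ).PairwiseDisjoint (firstExit X t 0) :=
    fun j _ j' _ h => firstExit_disjoint X t (Nat.zero_le _) (Nat.zero_le _) h
  have hwi : ∀ m n, Integrable (windowSum X m n) μ := fun m n =>
    integrable_finsetSum _ fun i _ => hint i
  have hw0 : ∀ m n, ∫ ω, windowSum X m n ω ∂μ = 0 := fun m n => by
    simp only [windowSum]
    rw [integral_finsetSum _ fun i _ => hint i, Finset.sum_eq_zero fun i _ => hmean i]
  rw [compl_staysIn X ht, measure_biUnion_finset hdisj hm, Finset.mul_sum]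
  calc ∑ j ∈ Finset.Ioc 0 N, ENNReal.ofReal t * μ (firstExit X t 0 j)
      ≤ ∑ j ∈ Finset.Ioc 0 N, ∫⁻ ω in firstExit X t 0 j, ‖∑ i, X i ω‖ₑ ∂μ := by
        refine Finset.sum_le_sum fun j hj => ?_
        have hjN := (Finset.mem_Ioc.1 hj).2
        calc ENNReal.ofReal t * μ (firstExit X t 0 j)
            = ∫⁻ ω in firstExit X t 0 j, ENNReal.ofReal t ∂μ := (setLIntegral_const _ _).symm
          _ ≤ ∫⁻ ω in firstExit X t 0 j, ‖windowSum X 0 j ω‖ₑ ∂μ :=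
              setLIntegral_mono' (hm j hj) fun ω hω => by
                rw [← ofReal_norm]
                exact ENNReal.ofReal_le_ofReal hω.1.le
          _ ≤ ∫⁻ ω in firstExit X t 0 j, ‖windowSum X 0 j ω + windowSum X j N ω‖ₑ ∂μ :=
              setLIntegral_enorm_le_setLIntegral_enorm_add (windowSigma_le hX 0 j)
                (windowSigma_le hX j N) (indep_windowSigma hX hind 0 j N)
                (measurableSet_firstExit X t le_rfl) (measurable_windowSum X le_rfl le_rfl)
                (measurable_windowSum X le_rfl le_rfl) (hwi _ _) (hw0 _ _)
          _ = _ := by simp only [windowSum_add X (Nat.zero_le j) hjN, windowSum_zero_card]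
    _ = ∫⁻ ω in ⋃ j ∈ Finset.Ioc 0 N, firstExit X t 0 j, ‖∑ i, X i ω‖ₑ ∂μ :=
        (lintegral_biUnion_finset hdisj hm _).symm
    _ ≤ _ := setLIntegral_le_lintegral _ _

/-- Two positions in the ball of radius `t / 2` differ by at most `t`. Hence staying there up to `n`
forces the walk restarted at `m` to stay within `t`, an event independent of the past. -/
theorem measureReal_staysIn_le (hX : ∀ i, Measurable (X i)) (hind : iIndepFun X μ) {t : ℝ}
    (ht : 0 ≤ t) {m n : ℕ} (hmn : m ≤ n) :
    μ.real (staysIn X (t / 2) 0 n) ≤ μ.real (staysIn X (t / 2) 0 m) *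
      (1 - ∑ j ∈ Finset.Ioc m n, μ.real (firstExit X t m j)) := by
  have hm1 := measurableSet_staysIn X (t / 2) 0 m
  have hm2 := measurableSet_staysIn X t m n
  rw [← measureReal_compl_staysIn hX ht, ← probReal_compl_eq_one_sub
      (windowSigma_le hX m n _ hm2).compl, compl_compl]
  have hprod := (Indep_iff _ _ μ).1 (indep_windowSigma hX hind 0 m n) _ _ hm1 hm2
  have hprod' : μ.real (staysIn X (t / 2) 0 m) * μ.real (staysIn X t m n) =
      μ.real (staysIn X (t / 2) 0 m ∩ staysIn X t m n) := by
    rw [measureReal_def, measureReal_def, measureReal_def, hprod, ENNReal.toReal_mul]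
  rw [hprod']
  refine measureReal_mono fun ω hω => ⟨fun l h1 h2 => hω l h1 (h2.trans hmn), fun l h1 h2 => ?_⟩
  have h3 := hω l (Nat.zero_le _) h2
  have h4 := hω m (Nat.zero_le _) hmn
  have h5 : windowSum X m l ω = windowSum X 0 l ω - windowSum X 0 m ω := by
    rw [← windowSum_add X (Nat.zero_le m) h1, add_sub_cancel_left]
  rw [h5]
  linarith [norm_sub_le (windowSum X 0 l ω) (windowSum X 0 m ω)]

/-- Poisson-type bound for the number of exits. -/
theorem measureReal_multiExit_le (hX : ∀ i, Measurable (X i)) (hind : iIndepFun X μ) {t : ℝ}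
    (ht : 0 ≤ t) (hpos : 0 < μ.real (staysIn X (t / 2) 0 N)) (k : ℕ) :
    μ.real (multiExit X t k 0) ≤
      ((1 - μ.real (staysIn X (t / 2) 0 N)) / μ.real (staysIn X (t / 2) 0 N)) ^ k
        / k.factorial := by
  set g : ℕ → ℝ := fun n => μ.real (staysIn X (t / 2) 0 n) with hg
  change 0 < g N at hpos
  change _ ≤ ((1 - g N) / g N) ^ k / k.factorial
  have hganti : Antitone g := fun m n hmn =>
    measureReal_mono fun ω hω l h1 h2 => hω l h1 (h2.trans hmn)
  have hg1 : ∀ n, g n ≤ 1 := fun n => measureReal_le_one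
  -- The restarted walk exits between `m` and `n` with probability at most `1 - g n / g m ≤ (g m - g
  -- n) / g N`, an increment of this function; it is the `h` of the renewal bound.
  have hmono : Monotone fun n => (1 - g n) / g N := fun m n hmn => by
    have := hganti hmn
    change (1 - g m) / g N ≤ (1 - g n) / g N
    gcongr
  have hr := renewal_bound (N := N) hmono (p := fun m j => μ.real (firstExit X t m j))
    (fun _ _ => measureReal_nonneg) (fun m n hmn hnN => ?_)
    (a := fun k m => μ.real (multiExit X t k m)) (fun _ => measureReal_le_one)
    (fun k m hm => ?_) k 0 (Nat.zero_le N)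
  · refine hr.trans ?_
    have h0 : 0 ≤ (1 - g 0) / g N := div_nonneg (by linarith [hg1 0]) hpos.le
    have h1 : (1 - g 0) / g N ≤ (1 - g N) / g N := hmono (Nat.zero_le N)
    have h2 : 0 ≤ (1 - g N) / g N - (1 - g 0) / g N := by linarith
    gcongr
    linarith
  · have h1 : g n ≤ g m * (1 - ∑ j ∈ Finset.Ioc m n, μ.real (firstExit X t m j)) :=
      measureReal_staysIn_le hX hind ht hmn
    have h2 : g N ≤ g m := hganti (hmn.trans hnN)
    have h3 : 0 ≤ ∑ j ∈ Finset.Ioc m n, μ.real (firstExit X t m j) :=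
      Finset.sum_nonneg fun _ _ => measureReal_nonneg
    rw [← sub_div, le_div_iff₀ hpos]
    nlinarith
  · refine (measureReal_biUnion_finset_le _ _).trans (Finset.sum_le_sum fun j hj => ?_)
    have hprod := (Indep_iff _ _ μ).1 (indep_windowSigma hX hind m j N) _ _
      (measurableSet_firstExit X t le_rfl) (measurableSet_multiExit X t k j)
    rw [measureReal_def, hprod, ENNReal.toReal_mul]
    rfl

/-- Doob's inequality at level `t / 2` gives `1 - g ≤ 2 / t ≤ 1 / 2` for the probability `g` of
staying in the ball of radius `t / 2`, whence `(1 - g) / g ≤ 4 / t`. -/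
theorem measure_multiExit_le [NormedSpace ℝ F] [CompleteSpace F]
    (hX : ∀ i, Measurable (X i)) (hind : iIndepFun X μ) (hint : ∀ i, Integrable (X i) μ)
    (hmean : ∀ i, ∫ ω, X i ω ∂μ = 0) (hS : ∫⁻ ω, ‖∑ i, X i ω‖ₑ ∂μ ≤ 1) {t : ℝ} (ht : 4 ≤ t)
    (k : ℕ) : μ (multiExit X t k 0) ≤ ENNReal.ofReal ((4 / t) ^ k / k.factorial) := by
  have ht0 : 0 < t := by linarith
  have hdoob := (mul_measure_compl_staysIn_le hX hind hint hmean
    (by positivity : 0 ≤ t / 2)).trans hS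
  rw [← ofReal_measureReal, ← ENNReal.ofReal_mul (by positivity), ENNReal.ofReal_le_one,
    probReal_compl_eq_one_sub (windowSigma_le hX 0 N _ (measurableSet_staysIn X (t / 2) 0 N))]
    at hdoob
  rw [← ofReal_measureReal]
  refine ENNReal.ofReal_le_ofReal ?_
  set g := μ.real (staysIn X (t / 2) 0 N) with hg
  have hg1 : g ≤ 1 := measureReal_le_one
  have hg2 : 1 / 2 ≤ g := by nlinarith
  refine (measureReal_multiExit_le hX hind ht0.le (by linarith) k).trans ?_
  rw [← hg]
  have h0 : 0 ≤ (1 - g) / g := div_nonneg (by linarith) (by linarith)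
  gcongr ?_ ^ k / _
  rw [div_le_div_iff₀ (by linarith) ht0]
  nlinarith

end WalkProbability

/-! ### The sum of the large steps. -/

section LargeValues

variable {Ω ι : Type*} [MeasurableSpace Ω] {μ : Measure Ω} [Fintype ι] {ξ : ι → Ω → ℝ}

/-- For independent variables whose maximum is unlikely to exceed `t`, the contributions of the
individual large values are controlled by that of the maximum. -/
theorem sum_lintegral_indicator_le (hξ : ∀ i, Measurable (ξ i)) (hind : iIndepFun ξ μ) {t : ℝ}
    (hhalf : 2⁻¹ ≤ μ {ω | ∀ i, ξ i ω ≤ t}) {φ : ℝ → ℝ≥0∞} (hφ : Measurable φ) :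
    ∑ i, ∫⁻ ω, {ω | t < ξ i ω}.indicator (fun ω => φ (ξ i ω)) ω ∂μ ≤
      2 * ∫⁻ ω, {ω | t < ⨆ i, ξ i ω}.indicator (fun ω => φ (⨆ i, ξ i ω)) ω ∂μ := by
  classical
  set f : ι → Ω → ℝ≥0∞ := fun i => {ω | t < ξ i ω}.indicator fun ω => φ (ξ i ω) with hf
  set B : ι → Set Ω := fun i => ⋂ j ∈ ({i}ᶜ : Set ι), {ω | ξ j ω ≤ t} with hB
  set σ : ι → MeasurableSpace Ω := fun i => ⨆ j ∈ ({i} : Set ι),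
    MeasurableSpace.comap (ξ j) inferInstance with hσ
  set τ : ι → MeasurableSpace Ω := fun i => ⨆ j ∈ ({i}ᶜ : Set ι),
    MeasurableSpace.comap (ξ j) inferInstance with hτ
  have hξσ : ∀ i, Measurable[σ i] (ξ i) := fun i =>
    Measurable.mono (comap_measurable (ξ i)) (le_iSup₂_of_le i rfl le_rfl) le_rfl
  have hξτ : ∀ i j, j ≠ i → Measurable[τ i] (ξ j) := fun i j hj =>
    Measurable.mono (comap_measurable (ξ j)) (le_iSup₂_of_le j hj le_rfl) le_rfl
  have hσle : ∀ i, σ i ≤ ‹MeasurableSpace Ω› := fun i => iSup₂_le fun j _ => (hξ j).comap_le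
  have hτle : ∀ i, τ i ≤ ‹MeasurableSpace Ω› := fun i => iSup₂_le fun j _ => (hξ j).comap_le
  have hstind : ∀ i, Indep (σ i) (τ i) μ := fun i =>
    indep_iSup_of_disjoint (fun j => (hξ j).comap_le) hind disjoint_compl_right
  have hfm : ∀ i, Measurable[σ i] (f i) := fun i => by
    refine Measurable.indicator (hφ.comp (hξσ i)) ?_
    exact hξσ i measurableSet_Ioi
  have hBm : ∀ i, MeasurableSet[τ i] (B i) := fun i => by
    let _ := τ i
    exact MeasurableSet.biInter (Set.to_countable _) fun j hj => hξτ i j hj measurableSet_Iic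
  have hgm : ∀ i, Measurable[τ i] ((B i).indicator fun _ => (1 : ℝ≥0∞)) := fun i =>
    Measurable.indicator (@measurable_const _ _ _ (τ i) _) (hBm i)
  -- `B i`, on which all other variables are at most `t`, is independent of `ξ i` and has
  -- probability at least `1 / 2`.
  have hstep : ∀ i, ∫⁻ ω, f i ω ∂μ ≤ 2 * ∫⁻ ω, f i ω * (B i).indicator (fun _ => 1) ω ∂μ := fun i => by
    rw [lintegral_mul_eq_lintegral_mul_lintegral_of_independent_measurableSpace (hσle i) (hτle i)
      (hstind i) (hfm i) (hgm i), lintegral_indicator_const (hτle i _ (hBm i)), one_mul]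
    have h1 : 2⁻¹ ≤ μ (B i) := hhalf.trans (measure_mono fun ω hω => by
      simp only [hB, Set.mem_iInter]
      exact fun j _ => hω j)
    calc ∫⁻ ω, f i ω ∂μ = 2 * ((∫⁻ ω, f i ω ∂μ) * 2⁻¹) := by
          rw [mul_comm, mul_assoc, ENNReal.inv_mul_cancel (by simp) (by simp), mul_one]
      _ ≤ _ := by gcongr
  calc ∑ i, ∫⁻ ω, f i ω ∂μ ≤ ∑ i, 2 * ∫⁻ ω, f i ω * (B i).indicator (fun _ => 1) ω ∂μ :=
        Finset.sum_le_sum fun i _ => hstep i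
    _ = 2 * ∫⁻ ω, ∑ i, f i ω * (B i).indicator (fun _ => 1) ω ∂μ := by
        rw [← Finset.mul_sum, lintegral_finsetSum]
        exact fun i _ => ((hfm i).mono (hσle i) le_rfl).mul ((hgm i).mono (hτle i) le_rfl)
    _ ≤ _ := by
        gcongr with ω
        -- At most one `i` can satisfy this, and then `ξ i` is the maximum, so the sum has at most
        -- one nonzero term.
        by_cases h : ∃ i, t < ξ i ω ∧ ω ∈ B i
        · obtain ⟨i, hi, hiB⟩ := h
          have hother : ∀ j, j ≠ i → ξ j ω ≤ t := fun j hj => by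
            simp only [hB, Set.mem_iInter] at hiB
            exact hiB j hj
          have : Nonempty ι := ⟨i⟩
          have hsup : ⨆ j, ξ j ω = ξ i ω := by
            refine le_antisymm (ciSup_le fun j => ?_)
              (le_ciSup (Set.finite_range fun j => ξ j ω).bddAbove i)
            rcases eq_or_ne j i with rfl | hj
            · exact le_rfl
            · exact (hother j hj).trans hi.le
          rw [Finset.sum_eq_single_of_mem i (Finset.mem_univ i)]
          · rw [Set.indicator_of_mem hiB, Set.indicator_of_mem (by rwa [Set.mem_ofPred_eq, hsup]),
              hsup, mul_one]
            exact Set.indicator_le_self _ _ _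
          · intro j _ hj
            have h0 : f j ω = 0 := Set.indicator_of_notMem (by simpa using hother j hj) _
            rw [h0, zero_mul]
        · push Not at h
          rw [Finset.sum_eq_zero]
          · exact zero_le
          · intro i _
            by_cases hi : t < ξ i ω
            · rw [Set.indicator_of_notMem (h i hi), mul_zero]
            · have h0 : f i ω = 0 := Set.indicator_of_notMem (by simpa using hi) _
              rw [h0, zero_mul]

/-- The sum of the large values among independent nonnegative variables has a bounded Orlicz
modular, provided the maximum does. -/
theorem lintegral_orlicz_sum_large_le [IsProbabilityMeasure μ] {Ψ : ℝ → ℝ}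
    (hΨ : IsOrliczFunction Ψ) {K : ℝ} (hK : 1 ≤ K)
    (hHJ : ∀ s u : ℝ, K ≤ s → K ≤ u →
      orliczExponent Ψ (s * u) ≤ K * (s * Real.log (1 + s) + s * orliczExponent Ψ u))
    (hξ : ∀ i, Measurable (ξ i)) (hξ0 : ∀ i ω, 0 ≤ ξ i ω) (hind : iIndepFun ξ μ)
    (hM : ∫⁻ ω, ENNReal.ofReal (Ψ (⨆ i, ξ i ω)) ∂μ ≤ 1) {t : ℝ} (ht : 72 * K ≤ t)
    (hΨt : 72 ≤ Ψ t) :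
    ∫⁻ ω, ENNReal.ofReal (Ψ ((∑ i with t < ξ i ω, ξ i ω) / (144 * K ^ 2))) ∂μ ≤ 2 := by
  classical
  have ht0 : 0 < t := by linarith
  set M : Ω → ℝ := fun ω => ⨆ i, ξ i ω with hMdef
  have hMm : Measurable M := Measurable.iSup hξ
  have hM0 : ∀ ω, 0 ≤ M ω := fun ω => Real.iSup_nonneg fun i => hξ0 i ω
  have hξM : ∀ i ω, ξ i ω ≤ M ω := fun i ω =>
    le_ciSup (Set.finite_range fun j => ξ j ω).bddAbove i
  set φ : ℝ → ℝ≥0∞ := fun x => 1 + ENNReal.ofReal (Ψ (max x 0 / 72)) with hφdef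
  have hφ : Measurable φ := measurable_const.add
    (hΨ.measurable_comp (by fun_prop) fun x => by positivity).ennreal_ofReal
  have htail : μ {ω | t < M ω} ≤ 72⁻¹ := by
    have h1 : Measurable fun ω => ENNReal.ofReal (Ψ (M ω)) :=
      (hΨ.measurable_comp hMm hM0).ennreal_ofReal
    have h2 := (mul_meas_ge_le_lintegral h1 72).trans hM
    rw [ENNReal.le_inv_iff_mul_le, mul_comm]
    refine le_trans ?_ h2
    gcongr with ω
    intro hω
    rw [← ENNReal.ofReal_ofNat]
    exact ENNReal.ofReal_le_ofReal (hΨt.trans (hΨ.mono ht0.le (le_of_lt hω)))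
  have hhalf : 2⁻¹ ≤ μ {ω | ∀ i, ξ i ω ≤ t} := by
    calc (2⁻¹ : ℝ≥0∞) = 1 - 2⁻¹ := ENNReal.one_sub_inv_two.symm
      _ ≤ 1 - μ {ω | t < M ω} := by
        refine tsub_le_tsub_left (htail.trans ?_) 1
        exact ENNReal.inv_le_inv.2 (by norm_num)
      _ = μ {ω | t < M ω}ᶜ := (prob_compl_eq_one_sub (measurableSet_lt measurable_const hMm)).symm
      _ ≤ _ := measure_mono fun ω hω i => (hξM i ω).trans (not_lt.1 hω)
  set v : ι → Ω → ℝ≥0∞ := fun i => {ω | t < ξ i ω}.indicator fun ω => φ (ξ i ω) with hv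
  have hvm : ∀ i, Measurable (v i) := fun i =>
    (hφ.comp (hξ i)).indicator (measurableSet_lt measurable_const (hξ i))
  have hvind : iIndepFun v μ := by
    have := hind.comp (fun _ => (Set.Ioi t).indicator φ) fun _ => hφ.indicator measurableSet_Ioi
    exact this
  -- The scale `72` is chosen so that `2 (1/72 + 1/72) = 1/18`, half of `1/9`: against the factor `9
  -- ^ n` the final series is geometric with ratio `1/2`.
  have hw : ∑ i, ∫⁻ ω, v i ω ∂μ ≤ 18⁻¹ := by
    refine (sum_lintegral_indicator_le hξ hind hhalf hφ).trans ?_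
    have h1 : ∀ ω, {ω | t < M ω}.indicator (fun ω => φ (M ω)) ω ≤
        {ω | t < M ω}.indicator (fun _ => 1) ω + 72⁻¹ * ENNReal.ofReal (Ψ (M ω)) := fun ω => by
      by_cases h : t < M ω
      · rw [Set.indicator_of_mem (by exact h), Set.indicator_of_mem (by exact h), hφdef]
        simp only [max_eq_left (hM0 ω)]
        gcongr
        have := hΨ.map_mul_le (θ := 72⁻¹) (by norm_num) (by norm_num) (hM0 ω)
        rw [div_eq_inv_mul]
        refine (ENNReal.ofReal_le_ofReal this).trans_eq ?_
        rw [ENNReal.ofReal_mul (by norm_num), ENNReal.ofReal_inv_of_pos (by norm_num),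
          ENNReal.ofReal_ofNat]
      · rw [Set.indicator_of_notMem (by exact h)]
        exact zero_le
    calc _ ≤ 2 * ∫⁻ ω, ({ω | t < M ω}.indicator (fun _ => 1) ω +
            72⁻¹ * ENNReal.ofReal (Ψ (M ω))) ∂μ := by
          gcongr with ω
          exact h1 ω
      _ = 2 * (μ {ω | t < M ω} + 72⁻¹ * ∫⁻ ω, ENNReal.ofReal (Ψ (M ω)) ∂μ) := by
          have hmt : MeasurableSet {ω | t < M ω} := measurableSet_lt measurable_const hMm
          rw [lintegral_add_left (measurable_const.indicator hmt),
            lintegral_const_mul _ (hΨ.measurable_comp hMm hM0).ennreal_ofReal,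
            lintegral_indicator_const hmt, one_mul]
      _ ≤ 2 * (72⁻¹ + 72⁻¹ * 1) := by gcongr
      _ ≤ 18⁻¹ := by
          refine le_of_eq ?_
          rw [← ENNReal.toReal_eq_toReal_iff' (by finiteness) (by finiteness), mul_one,
            ENNReal.toReal_mul, ENNReal.toReal_add (by finiteness) (by finiteness)]
          simp only [ENNReal.toReal_inv, ENNReal.toReal_ofNat]
          norm_num
  -- The bound for the random set of large indices is one term of a nonnegative sum over all
  -- deterministic `J`, whose expectations factor by independence.
  have hpt : ∀ ω, ENNReal.ofReal (Ψ ((∑ i with t < ξ i ω, ξ i ω) / (144 * K ^ 2))) ≤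
      ∑ J ∈ (Finset.univ : Finset ι).powerset, 9 ^ J.card * J.card.factorial * ∏ i ∈ J, v i ω := by
    intro ω
    set J : Finset ι := Finset.univ.filter fun i => t < ξ i ω with hJ
    have hJt : ∀ i ∈ J, t < ξ i ω := fun i hi => (Finset.mem_filter.1 hi).2
    have h1 := one_add_orlicz_sum_le hΨ hK hHJ J (fun i => ξ i ω / 72) fun i hi => by
      linarith [hJt i hi]
    rw [← Finset.sum_div, div_div, ← mul_assoc, show (72 * 2 : ℝ) = 144 by norm_num] at h1
    have hprod0 : 0 ≤ ∏ i ∈ J, (1 + Ψ (ξ i ω / 72)) := Finset.prod_nonneg fun i _ => by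
      linarith [hΨ.nonneg (div_nonneg (hξ0 i ω) (by norm_num : (0 : ℝ) ≤ 72))]
    have h2 : Ψ ((∑ i ∈ J, ξ i ω) / (144 * K ^ 2)) ≤
        9 ^ J.card * J.card.factorial * ∏ i ∈ J, (1 + Ψ (ξ i ω / 72)) :=
      (by linarith : _ ≤ _).trans (mul_le_mul_of_nonneg_right (one_add_two_mul_pow_le _) hprod0)
    have h3 : ENNReal.ofReal (9 ^ J.card * J.card.factorial * ∏ i ∈ J, (1 + Ψ (ξ i ω / 72))) =
        9 ^ J.card * J.card.factorial * ∏ i ∈ J, v i ω := by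
      rw [ENNReal.ofReal_mul (by positivity), ENNReal.ofReal_mul (by positivity),
        ENNReal.ofReal_pow (by norm_num), ENNReal.ofReal_natCast,
        ENNReal.ofReal_prod_of_nonneg fun i _ => by
          linarith [hΨ.nonneg (div_nonneg (hξ0 i ω) (by norm_num : (0 : ℝ) ≤ 72))]]
      congr 1
      · norm_num
      · refine Finset.prod_congr rfl fun i hi => ?_
        have h0 : v i ω = φ (ξ i ω) :=
          Set.indicator_of_mem (show ω ∈ {ω | t < ξ i ω} from hJt i hi) _
        rw [h0, hφdef]
        simp only [max_eq_left (hξ0 i ω)]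
        rw [ENNReal.ofReal_add zero_le_one (hΨ.nonneg (div_nonneg (hξ0 i ω) (by norm_num))),
          ENNReal.ofReal_one]
    refine (ENNReal.ofReal_le_ofReal h2).trans (h3.trans_le ?_)
    exact Finset.single_le_sum (f := fun J => 9 ^ J.card * J.card.factorial * ∏ i ∈ J, v i ω)
      (fun _ _ => zero_le) (Finset.mem_powerset.2 (Finset.subset_univ J))
  calc _ ≤ ∫⁻ ω, ∑ J ∈ (Finset.univ : Finset ι).powerset,
          9 ^ J.card * J.card.factorial * ∏ i ∈ J, v i ω ∂μ := lintegral_mono hpt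
    _ = ∑ J ∈ (Finset.univ : Finset ι).powerset,
          9 ^ J.card * J.card.factorial * ∏ i ∈ J, ∫⁻ ω, v i ω ∂μ := by
        rw [lintegral_finsetSum _ fun J _ => by fun_prop]
        refine Finset.sum_congr rfl fun J _ => ?_
        rw [lintegral_const_mul _ (by fun_prop),
          lintegral_prod_eq_prod_lintegral_of_indepFun J v hvind hvm]
    _ = ∑ n ∈ Finset.range (Fintype.card ι + 1), 9 ^ n * (n.factorial *
          ∑ J ∈ (Finset.univ : Finset ι).powersetCard n, ∏ i ∈ J, ∫⁻ ω, v i ω ∂μ) := by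
        rw [Finset.sum_powerset, Finset.card_univ]
        refine Finset.sum_congr rfl fun n _ => ?_
        rw [Finset.mul_sum, Finset.mul_sum]
        refine Finset.sum_congr rfl fun J hJ => ?_
        rw [(Finset.mem_powersetCard.1 hJ).2, mul_assoc]
    _ ≤ ∑ n ∈ Finset.range (Fintype.card ι + 1), 9 ^ n * (18⁻¹ : ℝ≥0∞) ^ n := by
        gcongr with n
        exact (factorial_mul_sum_powersetCard_prod_le _ _ n).trans (by gcongr)
    _ = ∑ n ∈ Finset.range (Fintype.card ι + 1), (2⁻¹ : ℝ≥0∞) ^ n := by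
        refine Finset.sum_congr rfl fun n _ => ?_
        rw [← mul_pow]
        congr 1
        rw [← ENNReal.toReal_eq_toReal_iff' (by finiteness) (by finiteness), ENNReal.toReal_mul]
        simp only [ENNReal.toReal_inv, ENNReal.toReal_ofNat]
        norm_num
    _ ≤ ∑' n, (2⁻¹ : ℝ≥0∞) ^ n := ENNReal.sum_le_tsum _
    _ = 2 := by rw [ENNReal.tsum_geometric, ENNReal.one_sub_inv_two, inv_inv]

end LargeValues

/-! ### The modular inequality for centred variables. -/

theorem succ_div_four_pow_le (n : ℕ) : ((n : ℝ) + 1) * (1 / 4) ^ n ≤ (1 / 2) ^ n := by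
  have h := one_add_mul_le_pow (show (-2 : ℝ) ≤ 1 by norm_num) n
  have h1 : ((1 : ℝ) / 4) ^ n * 2 ^ n = (1 / 2) ^ n := by rw [← mul_pow]; norm_num
  have h2 : (0 : ℝ) ≤ (1 / 4) ^ n := by positivity
  calc ((n : ℝ) + 1) * (1 / 4) ^ n ≤ 2 ^ n * (1 / 4) ^ n := by
        gcongr
        norm_num at h
        linarith
    _ = (1 / 2) ^ n := by rw [mul_comm, h1]

/-- The Poisson-type series dominating the Orlicz modular of the number of exits. -/
theorem tsum_orlicz_mul_pow_div_factorial_le {Ψ : ℝ → ℝ} (hΨ : IsOrliczFunction Ψ) {K : ℝ}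
    (hK : 1 ≤ K)
    (hHJ : ∀ s u : ℝ, K ≤ s → K ≤ u →
      orliczExponent Ψ (s * u) ≤ K * (s * Real.log (1 + s) + s * orliczExponent Ψ u))
    {t : ℝ} (ht : 144 * (1 + Ψ K) ≤ t) :
    ∑' n : ℕ, ENNReal.ofReal (Ψ ((n + 1) / (2 * K))) *
      ENNReal.ofReal ((4 / t) ^ n / n.factorial) ≤ ENNReal.ofReal (18 * (1 + Ψ K)) := by
  have hK0 : 0 < K := by linarith
  have hβ : 1 ≤ 1 + Ψ K := by linarith [hΨ.nonneg hK0.le]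
  set β := 1 + Ψ K with hβdef
  have ht0 : 0 < t := by linarith
  have hterm : ∀ n : ℕ, Ψ ((n + 1) / (2 * K)) * ((4 / t) ^ n / n.factorial) ≤
      9 * β * (1 / 2) ^ n := by
    intro n
    -- Writing `(n + 1) K` as a sum of `n + 1` copies of `K` bounds the growth of `Ψ` along the
    -- integers by `(9 β) ^ (n + 1) (n + 1)!`.
    have h1 := one_add_orlicz_sum_le hΨ hK hHJ (Finset.range (n + 1)) (fun _ => K)
      fun _ _ => le_rfl
    rw [Finset.sum_const, Finset.prod_const, Finset.card_range, nsmul_eq_mul, ← hβdef,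
      show ((n + 1 : ℕ) : ℝ) * K / (2 * K ^ 2) = (n + 1) / (2 * K) by push_cast; field_simp] at h1
    have h2 : Ψ ((n + 1) / (2 * K)) ≤ 9 ^ (n + 1) * (n + 1).factorial * β ^ (n + 1) := by
      refine (by linarith : _ ≤ _).trans
        (mul_le_mul_of_nonneg_right (one_add_two_mul_pow_le (n + 1)) (by positivity))
    calc Ψ ((n + 1) / (2 * K)) * ((4 / t) ^ n / n.factorial)
        ≤ 9 ^ (n + 1) * (n + 1).factorial * β ^ (n + 1) * ((4 / t) ^ n / n.factorial) := by gcongr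
      _ = 9 * β * ((n + 1) * (9 * β * (4 / t)) ^ n) := by
          rw [Nat.factorial_succ, mul_pow, mul_pow]
          push_cast
          field_simp
          ring
      _ ≤ 9 * β * ((n + 1) * (1 / 4) ^ n) := by
          gcongr
          rw [mul_div_assoc', div_le_div_iff₀ ht0 (by norm_num)]
          linarith
      _ ≤ 9 * β * (1 / 2) ^ n := by
          gcongr
          exact succ_div_four_pow_le n
  have hsum : Summable fun n : ℕ => 9 * β * (1 / 2 : ℝ) ^ n := summable_geometric_two.mul_left _
  calc _ ≤ ∑' n : ℕ, ENNReal.ofReal (9 * β * (1 / 2) ^ n) := by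
        refine ENNReal.tsum_le_tsum fun n => ?_
        rw [← ENNReal.ofReal_mul (hΨ.nonneg (by positivity))]
        exact ENNReal.ofReal_le_ofReal (hterm n)
    _ = ENNReal.ofReal (∑' n : ℕ, 9 * β * (1 / 2) ^ n) :=
        (ENNReal.ofReal_tsum_of_nonneg (fun n => by positivity) hsum).symm
    _ = ENNReal.ofReal (18 * β) := by
        rw [tsum_mul_left, tsum_geometric_two]
        congr 1; ring

section Modular

variable {Ω F : Type*} [MeasurableSpace Ω] {μ : Measure Ω} [IsProbabilityMeasure μ]
  [NormedAddCommGroup F] [NormedSpace ℝ F] [CompleteSpace F] [MeasurableSpace F] [BorelSpace F]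
  {N : ℕ} {X : Fin N → Ω → F} {Ψ : ℝ → ℝ}

/-- The modular form of the Hoffmann-Jørgensen inequality for centred variables. -/
theorem lintegral_orlicz_sum_le_of_centred [SecondCountableTopology F] (hΨ : IsOrliczFunction Ψ)
    {K : ℝ} (hK : 1 ≤ K)
    (hHJ : ∀ s u : ℝ, K ≤ s → K ≤ u →
      orliczExponent Ψ (s * u) ≤ K * (s * Real.log (1 + s) + s * orliczExponent Ψ u))
    {t : ℝ} (ht : 144 * (1 + Ψ K) ≤ t) (htK : 72 * K ≤ t) (hΨt : 72 ≤ Ψ t)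
    (hX : ∀ i, Measurable (X i)) (hind : iIndepFun X μ) (hint : ∀ i, Integrable (X i) μ)
    (hmean : ∀ i, ∫ ω, X i ω ∂μ = 0) (hS : ∫⁻ ω, ‖∑ i, X i ω‖ₑ ∂μ ≤ 1)
    (hM : ∫⁻ ω, ENNReal.ofReal (Ψ (⨆ i, ‖X i ω‖)) ∂μ ≤ 1) :
    ∫⁻ ω, ENNReal.ofReal (Ψ (‖∑ i, X i ω‖ / (144 * (1 + Ψ K) * t * K))) ∂μ ≤ 1 := by
  classical
  have hK0 : 0 < K := by linarith
  have hβ : 1 ≤ 1 + Ψ K := by linarith [hΨ.nonneg hK0.le]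
  set β := 1 + Ψ K with hβdef
  have ht0 : 0 < t := by linarith
  set D := 144 * β * t * K with hD
  have hD0 : 0 < D := by positivity
  have hDK : 576 * K ^ 2 ≤ D := by
    have h1 : 72 * K ≤ β * t := htK.trans (le_mul_of_one_le_left ht0.le hβ)
    have h2 : 72 * K * K ≤ β * t * K := by gcongr
    nlinarith
  set B : Ω → ℝ := fun ω => ∑ i with t < ‖X i ω‖, ‖X i ω‖ with hB
  have hB0 : ∀ ω, 0 ≤ B ω := fun ω => Finset.sum_nonneg fun _ _ => norm_nonneg _
  have hBm : Measurable B := by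
    have : B = fun ω => ∑ i, {ω | t < ‖X i ω‖}.indicator (fun ω => ‖X i ω‖) ω := by
      ext ω
      simp only [hB, Finset.sum_filter, Set.indicator_apply]
      rfl
    rw [this]
    exact Finset.measurable_fun_sum _ fun i _ =>
      (hX i).norm.indicator (measurableSet_lt measurable_const (hX i).norm)
  have hEm : ∀ n, MeasurableSet (multiExit X t n 0) := fun n =>
    windowSigma_le hX 0 N _ (measurableSet_multiExit X t n 0)
  set E : ℕ → Ω → ℝ≥0∞ := fun n => (multiExit X t n 0).indicator fun _ =>
    ENNReal.ofReal (Ψ ((n + 1) / (2 * K))) with hE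
  have hpt : ∀ ω, ENNReal.ofReal (Ψ (‖∑ i, X i ω‖ / D)) ≤
      ENNReal.ofReal (1 / (36 * β)) * ∑' n, E n ω +
        ENNReal.ofReal (1 / 4) * ENNReal.ofReal (Ψ (B ω / (144 * K ^ 2))) := by
    intro ω
    -- The least such `k` is positive because `multiExit X t 0 0` is everything; writing it as `n +
    -- 1`, the walk has exactly `n` exits.
    have hex : ∃ k, ω ∉ multiExit X t k 0 :=
      ⟨N + 1, by rw [multiExit_eq_empty X t (by omega) (Nat.zero_le N)]; exact Set.notMem_empty ω⟩
    obtain ⟨n, hn⟩ : ∃ n, Nat.find hex = n + 1 := Nat.exists_eq_succ_of_ne_zero fun h0 => by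
      have := Nat.find_spec hex
      rw [h0] at this
      exact this (Set.mem_univ ω)
    have hout : ω ∉ multiExit X t (n + 1) 0 := hn ▸ Nat.find_spec hex
    have hin : ω ∈ multiExit X t n 0 := not_not.1 (Nat.find_min hex (by omega))
    have hnorm := norm_windowSum_le_of_notMem_multiExit X ht0.le (Nat.zero_le N) hout
    rw [windowSum_zero_card] at hnorm
    simp only [Nat.zero_le, true_and] at hnorm
    change _ ≤ 2 * ((n + 1 : ℕ) : ℝ) * t + B ω at hnorm
    push_cast at hnorm
    have h1 : Ψ (4 * (n + 1) * t / D) ≤ 1 / (18 * β) * Ψ ((n + 1) / (2 * K)) := by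
      have := hΨ.map_mul_le (θ := 1 / (18 * β)) (x := (n + 1) / (2 * K)) (by positivity)
        (by rw [div_le_one (by positivity)]; linarith) (by positivity)
      rwa [show 1 / (18 * β) * ((n + 1) / (2 * K)) = 4 * (n + 1) * t / D by
        rw [hD]; field_simp; ring] at this
    have h2 : Ψ (2 * B ω / D) ≤ 1 / 2 * Ψ (B ω / (144 * K ^ 2)) := by
      have hBK : 0 ≤ B ω / (144 * K ^ 2) := div_nonneg (hB0 ω) (by positivity)
      refine le_trans (hΨ.mono (div_nonneg (by linarith [hB0 ω]) hD0.le) ?_)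
        (hΨ.map_mul_le (by norm_num) (by norm_num) hBK)
      rw [div_mul_div_comm, one_mul, div_le_div_iff₀ hD0 (by positivity)]
      nlinarith [mul_le_mul_of_nonneg_left hDK (hB0 ω)]
    -- The coefficients `1 / (36 β)` and `1 / 4` meet integral bounds `18 β` and `2`, so each part
    -- contributes `1 / 2`.
    have h3 : Ψ (‖∑ i, X i ω‖ / D) ≤
        1 / (36 * β) * Ψ ((n + 1) / (2 * K)) + 1 / 4 * Ψ (B ω / (144 * K ^ 2)) := by
      calc Ψ (‖∑ i, X i ω‖ / D) ≤ Ψ ((4 * (n + 1) * t / D + 2 * B ω / D) / 2) := by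
            refine hΨ.mono (by positivity) ?_
            rw [← add_div, div_div, div_le_div_iff₀ hD0 (by positivity)]
            nlinarith
        _ ≤ (Ψ (4 * (n + 1) * t / D) + Ψ (2 * B ω / D)) / 2 :=
            hΨ.map_half_add_le (by positivity) (div_nonneg (by linarith [hB0 ω]) hD0.le)
        _ ≤ (1 / (18 * β) * Ψ ((n + 1) / (2 * K)) + 1 / 2 * Ψ (B ω / (144 * K ^ 2))) / 2 := by
            linarith
        _ = _ := by field_simp; ring
    refine (ENNReal.ofReal_le_ofReal h3).trans ?_
    rw [ENNReal.ofReal_add (mul_nonneg (by positivity) (hΨ.nonneg (by positivity)))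
      (mul_nonneg (by positivity) (hΨ.nonneg (div_nonneg (hB0 ω) (by positivity)))),
      ENNReal.ofReal_mul (by positivity), ENNReal.ofReal_mul (by positivity)]
    gcongr
    calc ENNReal.ofReal (Ψ ((n + 1) / (2 * K))) = E n ω := by
          simp only [hE, Set.indicator_of_mem hin]
      _ ≤ _ := ENNReal.le_tsum n
  have hEsum : ∫⁻ ω, ∑' n, E n ω ∂μ ≤ ENNReal.ofReal (18 * β) := by
    rw [lintegral_tsum fun n => (measurable_const.indicator (hEm n)).aemeasurable]
    refine le_trans (ENNReal.tsum_le_tsum fun n => ?_)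
      (tsum_orlicz_mul_pow_div_factorial_le hΨ hK hHJ ht)
    rw [lintegral_indicator_const (hEm n)]
    gcongr
    exact measure_multiExit_le hX hind hint hmean hS (by linarith) n
  have hBint := lintegral_orlicz_sum_large_le hΨ hK hHJ (fun i => (hX i).norm)
    (fun i ω => norm_nonneg (X i ω)) (hind.comp (fun _ => norm) fun _ => measurable_norm) hM htK hΨt
  calc _ ≤ ∫⁻ ω, (ENNReal.ofReal (1 / (36 * β)) * ∑' n, E n ω +
          ENNReal.ofReal (1 / 4) * ENNReal.ofReal (Ψ (B ω / (144 * K ^ 2)))) ∂μ :=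
        lintegral_mono hpt
    _ = ENNReal.ofReal (1 / (36 * β)) * ∫⁻ ω, ∑' n, E n ω ∂μ +
          ENNReal.ofReal (1 / 4) * ∫⁻ ω, ENNReal.ofReal (Ψ (B ω / (144 * K ^ 2))) ∂μ := by
        have hEtm : Measurable fun ω => ∑' n, E n ω :=
          Measurable.tsum fun n => measurable_const.indicator (hEm n)
        rw [lintegral_add_left (hEtm.const_mul _), lintegral_const_mul _ hEtm,
          lintegral_const_mul _ (hΨ.measurable_comp (hBm.div_const _) fun ω =>
            div_nonneg (hB0 ω) (by positivity)).ennreal_ofReal]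
    _ ≤ ENNReal.ofReal (1 / (36 * β)) * ENNReal.ofReal (18 * β) + ENNReal.ofReal (1 / 4) *
          ENNReal.ofReal 2 := by
        gcongr
        rw [ENNReal.ofReal_ofNat]
        exact hBint
    _ = 1 := by
        rw [← ENNReal.ofReal_mul (by positivity), ← ENNReal.ofReal_mul (by positivity),
          ← ENNReal.ofReal_add (by positivity) (by positivity), ← ENNReal.ofReal_one]
        congr 1
        field_simp
        norm_num

end Modular

/-! ### Removing the centring assumption. -/

section Modular

variable {Ω F : Type*} [MeasurableSpace Ω] {μ : Measure Ω} [IsProbabilityMeasure μ]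
  [NormedAddCommGroup F] [NormedSpace ℝ F] [CompleteSpace F] [MeasurableSpace F] [BorelSpace F]
  {N : ℕ} {X : Fin N → Ω → F} {Ψ : ℝ → ℝ}

/-- A modular Hoffmann-Jørgensen inequality for centred variables passes to general variables. -/
theorem lintegral_orlicz_sum_le_of_forall_centred [SecondCountableTopology F]
    (hΨ : IsOrliczFunction Ψ) {D : ℝ} (hD : 0 < D)
    (hcent : ∀ Y : Fin N → Ω → F, (∀ i, Measurable (Y i)) → iIndepFun Y μ →
      (∀ i, Integrable (Y i) μ) → (∀ i, ∫ ω, Y i ω ∂μ = 0) → ∫⁻ ω, ‖∑ i, Y i ω‖ₑ ∂μ ≤ 1 →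
      ∫⁻ ω, ENNReal.ofReal (Ψ (⨆ i, ‖Y i ω‖)) ∂μ ≤ 1 →
      ∫⁻ ω, ENNReal.ofReal (Ψ (‖∑ i, Y i ω‖ / D)) ∂μ ≤ 1)
    (hX : ∀ i, Measurable (X i)) (hind : iIndepFun X μ) (hS : ∫⁻ ω, ‖∑ i, X i ω‖ₑ ∂μ ≤ 1)
    (hM : ∫⁻ ω, ENNReal.ofReal (Ψ (⨆ i, ‖X i ω‖)) ∂μ ≤ 1) :
    ∫⁻ ω, ENNReal.ofReal (Ψ (‖∑ i, X i ω‖ /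
      (2 * (2 * (1 + 1 / Ψ 1) * (1 + Ψ 1)) * D + 2 * (1 + Ψ 1)))) ∂μ ≤ 1 := by
  have hΨ1 := hΨ.map_one_pos
  set m : ℝ := 1 + 1 / Ψ 1 with hm
  have hm1 : 1 ≤ m := by
    have : 0 < 1 / Ψ 1 := by positivity
    linarith
  have h2 := hΨ.map_one_div_le_one
  -- `m` bounds `E ‖Xᵢ‖`. Dividing by `c` brings the mean of `Xᵢ` down to `1 / (2 (1 + Ψ 1))`, and
  -- `c ≥ 2` leaves at most half of the maximum; convexity then gives the centred variables modular
  -- at most `1 / 2 + 1 / 2`.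
  set c : ℝ := 2 * m * (1 + Ψ 1) with hc
  have hc2 : 2 ≤ c := by nlinarith
  have hc0 : 0 < c := by linarith
  set M : Ω → ℝ := fun ω => ⨆ i, ‖X i ω‖ with hMdef
  have hMm : Measurable M := Measurable.iSup fun i => (hX i).norm
  have hM0 : ∀ ω, 0 ≤ M ω := fun ω => Real.iSup_nonneg fun i => norm_nonneg _
  have hXM : ∀ i ω, ‖X i ω‖ ≤ M ω := fun i ω =>
    le_ciSup (Set.finite_range fun j => ‖X j ω‖).bddAbove i
  have hΨMm : Measurable fun ω => ENNReal.ofReal (Ψ (M ω)) :=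
    (hΨ.measurable_comp hMm hM0).ennreal_ofReal
  have hXL1 : ∀ i, ∫⁻ ω, ‖X i ω‖ₑ ∂μ ≤ ENNReal.ofReal m := fun i => by
    calc ∫⁻ ω, ‖X i ω‖ₑ ∂μ
        ≤ ∫⁻ ω, (1 + ENNReal.ofReal (1 / Ψ 1) * ENNReal.ofReal (Ψ (M ω))) ∂μ := by
          refine lintegral_mono fun ω => ?_
          rw [← ofReal_norm, ← ENNReal.ofReal_mul (by positivity), ← ENNReal.ofReal_one,
            ← ENNReal.ofReal_add zero_le_one (mul_nonneg (by positivity) (hΨ.nonneg (hM0 ω)))]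
          refine ENNReal.ofReal_le_ofReal ((hXM i ω).trans ?_)
          have := hΨ.le_one_add_div (hM0 ω)
          rwa [one_div_mul_eq_div]
      _ = 1 + ENNReal.ofReal (1 / Ψ 1) * ∫⁻ ω, ENNReal.ofReal (Ψ (M ω)) ∂μ := by
          rw [lintegral_add_left measurable_const, lintegral_const_mul _ hΨMm]
          simp
      _ ≤ 1 + ENNReal.ofReal (1 / Ψ 1) * 1 := by gcongr
      _ = ENNReal.ofReal m := by
          rw [mul_one, hm, ENNReal.ofReal_add zero_le_one (by positivity), ENNReal.ofReal_one]
  have hint : ∀ i, Integrable (X i) μ := fun i =>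
    ⟨(hX i).aestronglyMeasurable, (hXL1 i).trans_lt ENNReal.ofReal_lt_top⟩
  set a : Fin N → F := fun i => ∫ ω, X i ω ∂μ with ha
  have ham : ∀ i, ‖a i‖ ≤ m := fun i => by
    have := (enorm_integral_le_lintegral_enorm (X i)).trans (hXL1 i)
    rw [← ofReal_norm] at this
    exact (ENNReal.ofReal_le_ofReal_iff (by linarith)).1 this
  have hasum : ∑ i, a i = ∫ ω, ∑ i, X i ω ∂μ := (integral_finsetSum _ fun i _ => hint i).symm
  have haS : ‖∑ i, a i‖ₑ ≤ 1 := by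
    rw [hasum]
    exact (enorm_integral_le_lintegral_enorm _).trans hS
  have haS' : ‖∑ i, a i‖ ≤ 1 := by
    rwa [← ofReal_norm, ENNReal.ofReal_le_one] at haS
  set Y : Fin N → Ω → F := fun i ω => c⁻¹ • (X i ω - a i) with hY
  have hYsum : ∀ ω, ∑ i, Y i ω = c⁻¹ • (∑ i, X i ω - ∑ i, a i) := fun ω => by
    simp only [hY]
    rw [← Finset.smul_sum, Finset.sum_sub_distrib]
  have hSm : Measurable fun ω => ∑ i, X i ω := Finset.measurable_fun_sum _ fun i _ => hX i
  have hYint := hcent Y (fun i => ((hX i).sub_const _).const_smul _)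
    (hind.comp (fun i x => c⁻¹ • (x - a i)) fun i => (measurable_id.sub_const _).const_smul _)
    (fun i => ((hint i).sub (integrable_const _)).smul c⁻¹)
    (fun i => by
      simp only [hY]
      rw [integral_smul, integral_sub (hint i) (integrable_const _)]
      simp [ha])
    (by
      simp only [hYsum, enorm_smul]
      rw [lintegral_const_mul _ (hSm.sub_const _).enorm]
      have h1 : ‖c⁻¹‖ₑ ≤ 2⁻¹ := by
        rw [Real.enorm_of_nonneg (by positivity), ENNReal.ofReal_inv_of_pos hc0,
          ENNReal.inv_le_inv, ← ENNReal.ofReal_ofNat]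
        exact ENNReal.ofReal_le_ofReal hc2
      have h2 : ∫⁻ ω, ‖∑ i, X i ω - ∑ i, a i‖ₑ ∂μ ≤ 2 := by
        calc _ ≤ ∫⁻ ω, (‖∑ i, X i ω‖ₑ + ‖∑ i, a i‖ₑ) ∂μ := lintegral_mono fun ω => enorm_sub_le
          _ = ∫⁻ ω, ‖∑ i, X i ω‖ₑ ∂μ + ‖∑ i, a i‖ₑ := by
            rw [lintegral_add_left hSm.enorm]; simp
          _ ≤ 1 + 1 := by gcongr
          _ = 2 := one_add_one_eq_two
      calc _ ≤ (2⁻¹ : ℝ≥0∞) * 2 := by gcongr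
        _ = 1 := ENNReal.inv_mul_cancel (by simp) (by simp))
    (by
      have hpt : ∀ ω, ENNReal.ofReal (Ψ (⨆ i, ‖Y i ω‖)) ≤
          2⁻¹ * ENNReal.ofReal (Ψ (M ω)) + 2⁻¹ := fun ω => by
        have h1 : ⨆ i, ‖Y i ω‖ ≤ (M ω + 1 / (1 + Ψ 1)) / 2 := by
          refine Real.iSup_le (fun i => ?_) (by have := hM0 ω; positivity)
          calc ‖Y i ω‖ = c⁻¹ * ‖X i ω - a i‖ := by
                rw [hY, norm_smul, Real.norm_of_nonneg (by positivity)]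
            _ ≤ c⁻¹ * (M ω + m) := by
                gcongr
                exact (norm_sub_le _ _).trans (add_le_add (hXM i ω) (ham i))
            _ = c⁻¹ * M ω + 1 / (1 + Ψ 1) / 2 := by rw [hc]; field_simp
            _ ≤ 2⁻¹ * M ω + 1 / (1 + Ψ 1) / 2 := by
                have := hM0 ω
                gcongr
            _ = _ := by ring
        have h4 : Ψ (⨆ i, ‖Y i ω‖) ≤ 2⁻¹ * Ψ (M ω) + 2⁻¹ := by
          have := (hΨ.mono (Real.iSup_nonneg fun i => norm_nonneg _) h1).trans
            (hΨ.map_half_add_le (hM0 ω) (by positivity))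
          linarith
        refine (ENNReal.ofReal_le_ofReal h4).trans_eq ?_
        rw [ENNReal.ofReal_add (mul_nonneg (by norm_num) (hΨ.nonneg (hM0 ω))) (by norm_num),
          ENNReal.ofReal_mul (by norm_num), ENNReal.ofReal_inv_of_pos (by norm_num),
          ENNReal.ofReal_ofNat]
      calc _ ≤ ∫⁻ ω, (2⁻¹ * ENNReal.ofReal (Ψ (M ω)) + 2⁻¹) ∂μ := lintegral_mono hpt
        _ = 2⁻¹ * ∫⁻ ω, ENNReal.ofReal (Ψ (M ω)) ∂μ + 2⁻¹ := by
          rw [lintegral_add_right _ measurable_const, lintegral_const_mul _ hΨMm]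
          simp
        _ ≤ 2⁻¹ * 1 + 2⁻¹ := by gcongr
        _ = 1 := by rw [mul_one, ENNReal.inv_two_add_inv_two])
  -- The first summand halves the centred sum at scale `D`, the second halves the total mean, of
  -- norm at most `1`, against `1 / (1 + Ψ 1)`.
  set D' : ℝ := 2 * c * D + 2 * (1 + Ψ 1) with hD'
  have hD'0 : 0 < D' := by positivity
  have hpt : ∀ ω, ENNReal.ofReal (Ψ (‖∑ i, X i ω‖ / D')) ≤
      2⁻¹ * ENNReal.ofReal (Ψ (‖∑ i, Y i ω‖ / D)) + 2⁻¹ := fun ω => by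
    have h1 : ‖∑ i, X i ω‖ ≤ c * ‖∑ i, Y i ω‖ + 1 := by
      have h2 : ∑ i, X i ω = c • ∑ i, Y i ω + ∑ i, a i := by
        rw [hYsum, smul_inv_smul₀ hc0.ne', sub_add_cancel]
      calc ‖∑ i, X i ω‖ ≤ ‖c • ∑ i, Y i ω‖ + ‖∑ i, a i‖ := by
            rw [h2]; exact norm_add_le _ _
        _ ≤ _ := by
            rw [norm_smul, Real.norm_of_nonneg hc0.le]
            gcongr
    have h3 : ‖∑ i, X i ω‖ / D' ≤ (‖∑ i, Y i ω‖ / D + 1 / (1 + Ψ 1)) / 2 := by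
      have h4 : c * ‖∑ i, Y i ω‖ / D' ≤ ‖∑ i, Y i ω‖ / D / 2 := by
        rw [div_div, div_le_div_iff₀ hD'0 (by positivity)]
        have : c * D * 2 ≤ D' := by
          rw [hD']; linarith
        have h5 := mul_le_mul_of_nonneg_left this (norm_nonneg (∑ i, Y i ω))
        linarith
      have h5 : 1 / D' ≤ 1 / (1 + Ψ 1) / 2 := by
        rw [div_div]
        apply one_div_le_one_div_of_le (by positivity)
        have : 0 < 2 * c * D := by positivity
        linarith
      calc ‖∑ i, X i ω‖ / D' ≤ (c * ‖∑ i, Y i ω‖ + 1) / D' := by gcongr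
        _ = c * ‖∑ i, Y i ω‖ / D' + 1 / D' := add_div _ _ _
        _ ≤ _ := by linarith
    have h4 : Ψ (‖∑ i, X i ω‖ / D') ≤ 2⁻¹ * Ψ (‖∑ i, Y i ω‖ / D) + 2⁻¹ := by
      have := (hΨ.mono (by positivity) h3).trans (hΨ.map_half_add_le (by positivity) (by positivity))
      linarith
    refine (ENNReal.ofReal_le_ofReal h4).trans_eq ?_
    rw [ENNReal.ofReal_add (mul_nonneg (by norm_num) (hΨ.nonneg (by positivity))) (by norm_num),
      ENNReal.ofReal_mul (by norm_num), ENNReal.ofReal_inv_of_pos (by norm_num),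
      ENNReal.ofReal_ofNat]
  calc _ ≤ ∫⁻ ω, (2⁻¹ * ENNReal.ofReal (Ψ (‖∑ i, Y i ω‖ / D)) + 2⁻¹) ∂μ := lintegral_mono hpt
    _ = 2⁻¹ * ∫⁻ ω, ENNReal.ofReal (Ψ (‖∑ i, Y i ω‖ / D)) ∂μ + 2⁻¹ := by
      rw [lintegral_add_right _ measurable_const, lintegral_const_mul' _ _ (by simp)]
      simp
    _ ≤ 2⁻¹ * 1 + 2⁻¹ := by gcongr
    _ = 1 := by rw [mul_one, ENNReal.inv_two_add_inv_two]

end Modular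

/-- Under (HJ) the modular form of the Hoffmann-Jørgensen inequality holds in all separable Banach
spaces with a constant depending only on `Ψ`. -/
theorem ConditionHJ.exists_lintegral_orlicz_sum_le.{u, v} {Ψ : ℝ → ℝ} (hΨ : IsOrliczFunction Ψ)
    (h : ConditionHJ Ψ) :
    ∃ D : ℝ≥0, 0 < D ∧ ∀ (F : Type u) [NormedAddCommGroup F] [NormedSpace ℝ F] [CompleteSpace F]
      [MeasurableSpace F] [BorelSpace F] [SecondCountableTopology F]
      (Ω : Type v) [MeasurableSpace Ω] (μ : Measure Ω) [IsProbabilityMeasure μ]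
      (N : ℕ) (X : Fin N → Ω → F), (∀ i, Measurable (X i)) → iIndepFun X μ →
      ∫⁻ ω, ‖∑ i, X i ω‖ₑ ∂μ ≤ 1 → ∫⁻ ω, ENNReal.ofReal (Ψ (⨆ i, ‖X i ω‖)) ∂μ ≤ 1 →
      ∫⁻ ω, ENNReal.ofReal (Ψ (‖∑ i, X i ω‖ / D)) ∂μ ≤ 1 := by
  obtain ⟨K, hK, hHJ⟩ := h.exists_one_le hΨ
  have hΨ1 := hΨ.map_one_pos
  have hβ : 1 ≤ 1 + Ψ K := by linarith [hΨ.nonneg (by linarith : 0 ≤ K)]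
  set t : ℝ := max (max (144 * (1 + Ψ K)) (72 * K)) (72 / Ψ 1) with ht
  have ht1 : 144 * (1 + Ψ K) ≤ t := (le_max_left _ _).trans (le_max_left _ _)
  have ht2 : 72 * K ≤ t := (le_max_right _ _).trans (le_max_left _ _)
  have ht3 : 72 / Ψ 1 ≤ t := le_max_right _ _
  have hΨt : 72 ≤ Ψ t :=
    ((div_le_iff₀ hΨ1).1 ht3).trans (hΨ.mul_map_one_le (by linarith))
  have ht0 : 0 < t := by linarith
  set D : ℝ := 144 * (1 + Ψ K) * t * K with hD
  have hD0 : 0 < D := by positivity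
  set D' : ℝ := 2 * (2 * (1 + 1 / Ψ 1) * (1 + Ψ 1)) * D + 2 * (1 + Ψ 1) with hD'
  have hD'0 : 0 < D' := by positivity
  refine ⟨⟨D', hD'0.le⟩, hD'0, ?_⟩
  intro F _ _ _ _ _ _ Ω _ μ _ N X hX hind hS hM
  exact lintegral_orlicz_sum_le_of_forall_centred hΨ hD0
    (fun Y hY hYind hYint hYmean hYS hYM => lintegral_orlicz_sum_le_of_centred hΨ hK hHJ ht1 ht2 hΨt
      hY hYind hYint hYmean hYS hYM) hX hind hS hM

/-! ### From the modular to the norm, and from separable to arbitrary Banach spaces. -/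

/-- Independent strongly measurable variables take values in a common closed separable subspace,
in which they are independent. -/
theorem exists_separable_submodule_iIndepFun {Ω F : Type*} [MeasurableSpace Ω] {μ : Measure Ω}
    [NormedAddCommGroup F] [NormedSpace ℝ F] [MeasurableSpace F] [BorelSpace F] {N : ℕ}
    {X : Fin N → Ω → F} (hX : ∀ i, StronglyMeasurable (X i)) (hind : iIndepFun X μ) :
    ∃ V : Submodule ℝ F, IsClosed (V : Set F) ∧ SecondCountableTopology V ∧
      ∃ Y : Fin N → Ω → V, (∀ i ω, (Y i ω : F) = X i ω) ∧ (∀ i, Measurable (Y i)) ∧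
        iIndepFun Y μ := by
  set V := (Submodule.span ℝ (⋃ i, Set.range (X i))).topologicalClosure with hV
  have hsep : TopologicalSpace.IsSeparable (V : Set F) := by
    rw [hV, Submodule.topologicalClosure_coe]
    exact (TopologicalSpace.IsSeparable.iUnion fun i => (hX i).isSeparable_range).span.closure
  have hmem : ∀ i ω, X i ω ∈ V := fun i ω => Submodule.le_topologicalClosure _
    (Submodule.subset_span (Set.mem_iUnion.2 ⟨i, Set.mem_range_self ω⟩))
  have : TopologicalSpace.SeparableSpace V := hsep.separableSpace
  refine ⟨V, Submodule.isClosed_topologicalClosure _,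
    UniformSpace.secondCountable_of_separable V, fun i ω => ⟨X i ω, hmem i ω⟩, fun _ _ => rfl,
    fun i => (hX i).measurable.subtype_mk, ?_⟩
  rw [iIndepFun_iff_iIndep] at hind ⊢
  convert hind using 2 with i
  -- `V` carries the trace σ-algebra, so `Y i` and `X i` generate the same σ-algebra on `Ω`.
  exact MeasurableSpace.comap_comp

theorem ConditionHJ.exists_hoffmannJorgensenInequality.{u, v} {Ψ : ℝ → ℝ}
    (hΨ : IsOrliczFunction Ψ) (h : ConditionHJ Ψ) :
    ∃ D : ℝ≥0, ∀ (F : Type u) [NormedAddCommGroup F] [NormedSpace ℝ F] [CompleteSpace F]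
      [MeasurableSpace F] [BorelSpace F]
      (Ω : Type v) [MeasurableSpace Ω] (μ : Measure Ω) [IsProbabilityMeasure μ]
      (N : ℕ) (X : Fin N → Ω → F), (∀ i, IsRadonVariable (X i)) → iIndepFun X μ →
      HoffmannJorgensenInequality Ψ D μ X := by
  obtain ⟨D, hD, hmod⟩ := h.exists_lintegral_orlicz_sum_le.{u, v} hΨ
  refine ⟨D, ?_⟩
  intro F _ _ _ _ _ Ω _ μ _ N X hX hind
  obtain ⟨V, hVc, hV2, Y, hYX, hYm, hYind⟩ := exists_separable_submodule_iIndepFun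
    (fun i => (isRadonVariable_iff_stronglyMeasurable (X i)).1 (hX i)) hind
  have : CompleteSpace V := hVc.completeSpace_coe
  have hsum : ∀ ω, ‖∑ i, X i ω‖ = ‖∑ i, Y i ω‖ := fun ω => by
    rw [Submodule.coe_norm]
    push_cast
    simp only [hYX]
  have hnorm : ∀ i ω, ‖X i ω‖ = ‖Y i ω‖ := fun i ω => by rw [← hYX, Submodule.coe_norm]
  have hSm : Measurable fun ω => ∑ i, Y i ω := Finset.measurable_fun_sum _ fun i _ => hYm i
  unfold HoffmannJorgensenInequality
  set A := eLpNorm (fun ω => ∑ i, X i ω) 1 μ with hA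
  set R := orliczNorm Ψ μ (fun ω => ⨆ i, ‖X i ω‖) with hR
  -- Since `0 * ∞ = 0`, positivity of `D` is what settles the cases of an infinite right-hand side.
  have hD' : (D : ℝ≥0∞) ≠ 0 := by simpa using hD.ne'
  by_cases hAtop : A = ∞
  · rw [hAtop, top_add, ENNReal.mul_top hD']
    exact le_top
  by_cases hRtop : R = ∞
  · rw [hRtop, add_top, ENNReal.mul_top hD']
    exact le_top
  refine ENNReal.le_of_forall_pos_le_add fun ε hε _ => ?_
  lift A to ℝ≥0 using hAtop with A' hA'
  lift R to ℝ≥0 using hRtop with R' hR'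
  -- The slack puts `b` strictly above the Orlicz norm of the maximum, keeps the scale `c = A' + b`
  -- positive, and costs exactly `ε` in `D * c`.
  set b : ℝ≥0 := R' + ε / D with hb
  have hb0 : 0 < b := by positivity
  set c : ℝ≥0 := A' + b with hc
  have hc0 : 0 < c := by positivity
  have hcR : (0 : ℝ) < c := by exact_mod_cast hc0
  have hRb : orliczNorm Ψ μ (fun ω => ⨆ i, ‖X i ω‖) < b := by
    rw [← hR, hb, ENNReal.coe_lt_coe]
    exact lt_add_of_pos_right _ (by positivity)
  have hMint := hΨ.lintegral_le_one_of_orliczNorm_lt hRb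
  have hZsum : ∀ ω, ∑ i, (c : ℝ)⁻¹ • Y i ω = (c : ℝ)⁻¹ • ∑ i, Y i ω := fun ω =>
    Finset.smul_sum.symm
  have hZ := hmod V Ω μ N (fun i ω => (c : ℝ)⁻¹ • Y i ω) (fun i => (hYm i).fun_const_smul _)
    (hYind.comp (fun _ x => (c : ℝ)⁻¹ • x) fun _ => measurable_id.fun_const_smul _)
    (by
      simp only [hZsum, enorm_smul]
      rw [lintegral_const_mul _ hSm.enorm]
      have h1 : ∫⁻ ω, ‖∑ i, Y i ω‖ₑ ∂μ = A' := by
        rw [hA, eLpNorm_one_eq_lintegral_enorm]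
        refine lintegral_congr fun ω => ?_
        rw [← ofReal_norm, ← ofReal_norm, hsum]
      rw [h1, Real.enorm_of_nonneg (by positivity), ENNReal.ofReal_inv_of_pos hcR,
        ENNReal.ofReal_coe_nnreal, mul_comm, ← div_eq_mul_inv]
      refine ENNReal.div_le_of_le_mul ?_
      rw [one_mul, ENNReal.coe_le_coe, hc]
      exact le_self_add)
    (by
      refine le_trans (lintegral_mono fun ω => ENNReal.ofReal_le_ofReal (hΨ.mono
        (Real.iSup_nonneg fun i => norm_nonneg _) ?_)) hMint
      refine Real.iSup_le (fun i => ?_) (by positivity)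
      rw [norm_smul, norm_inv, Real.norm_of_nonneg hcR.le, ← hnorm, inv_mul_eq_div]
      have h1 : ‖X i ω‖ ≤ ‖⨆ j, ‖X j ω‖‖ :=
        (le_ciSup (Set.finite_range fun j => ‖X j ω‖).bddAbove i).trans (Real.le_norm_self _)
      have h2 : (b : ℝ) ≤ c := by exact_mod_cast (le_add_self : b ≤ A' + b)
      have h3 : (0 : ℝ) < b := by exact_mod_cast hb0
      gcongr)
  have hfinal : orliczNorm Ψ μ (fun ω => ∑ i, X i ω) ≤ ((D * c : ℝ≥0) : ℝ≥0∞) := by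
    refine orliczNorm_le_of_lintegral_le (by positivity) (le_trans (le_of_eq ?_) hZ)
    refine lintegral_congr fun ω => ?_
    rw [hZsum, norm_smul, norm_inv, Real.norm_of_nonneg hcR.le, hsum]
    congr 2
    push_cast
    rw [div_mul_eq_div_div_swap, inv_mul_eq_div]
  refine hfinal.trans (le_of_eq ?_)
  rw [← ENNReal.coe_add, ← ENNReal.coe_mul, ← ENNReal.coe_add, ENNReal.coe_inj, hc, hb, ← add_assoc,
    mul_add D (A' + R'), mul_div_cancel₀ _ hD.ne']

theorem theorem3p1 (Ψ : ℝ → ℝ) (hΨ : IsOrliczFunction Ψ) :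
    ((∃ D : ℝ≥0, ∀ (Ω : Type) [MeasurableSpace Ω] (μ : Measure Ω) [IsProbabilityMeasure μ]
        (N : ℕ) (X : Fin N → Ω → ℝ),
        (∀ i, Measurable (X i)) →
        iIndepFun X μ →
        (∀ i j, IdentDistrib (X i) (X j) μ μ) →
        (∀ i, IdentDistrib (X i) (fun ω => -X i ω) μ μ) →
        (∃ M : ℝ, ∀ i ω, |X i ω| ≤ M) →
        HoffmannJorgensenInequality Ψ D μ X) →
      ConditionHJ Ψ) ∧
    (ConditionHJ Ψ →
      ∃ D : ℝ≥0, ∀ (F : Type*) [NormedAddCommGroup F] [NormedSpace ℝ F] [CompleteSpace F]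
        [MeasurableSpace F] [BorelSpace F]
        (Ω : Type*) [MeasurableSpace Ω] (μ : Measure Ω) [IsProbabilityMeasure μ]
        (N : ℕ) (X : Fin N → Ω → F),
        (∀ i, IsRadonVariable (X i)) →
        iIndepFun X μ →
        HoffmannJorgensenInequality Ψ D μ X) :=
  ⟨fun ⟨_, hD⟩ => conditionHJ_of_hoffmannJorgensenInequality hΨ hD,
    fun h => h.exists_hoffmannJorgensenInequality hΨ⟩
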